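/- **Theorem 3.3.** Let $(M_1,g_1)$ be a Riemannian manifold and $(M_2,g_2,J)$ a Kähler manifold (a Riemannian manifold with a smooth $(1,1)$-tensor $J$ such that $J^2=-I$, $g_2(JX,JY)=g_2(X,Y)$ and $\nabla^2 J=0$), with Levi-Civita connections $\nabla^1,\nabla^2$. Let $F:M_1\to M_2$ be a slant Riemannian map with slant angle $\theta$: $F$ is smooth, $g_2(F_*X,F_*Y)=g_1(X,Y)$ for all $X,Y\in(\ker F_{*p})^\perp$, $p\in M_1$, and for every $p\in M_1$ and every nonzero $X\in(\ker F_{*p})^\perp$ the angle between $JF_*X$ and the subspace $\operatorname{range}F_{*p}$ equals the constant $\theta$. Let $\nabla^F$ be the pullback of $\nabla^2$ along $F$, let $(\nabla F_*)(X,Y)=\nabla^F_XF_*Y-F_*(\nabla^1_XY)$ be the second fundamental form of $F$, and call $F$ totally geodesic if $(\nabla F_*)(X,Y)=0$ for all $X,Y\in\Gamma(TM_1)$. Let $(\operatorname{range}F_*)^\perp$ be the bundle over $M_1$ with fibre $(F_*(T_pM_1))^\perp\subset T_{F(p)}M_2$ at $p$. For $u\in\operatorname{range}F_*$ write $Ju=\phi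 u+\omega u$ and for $V\in(\operatorname{range}F_*)^\perp$ write $JV=\mathcal BV+\mathcal CV$, where $\phi u,\mathcal BV\in\operatorname{range}F_*$ and $\omega u,\mathcal CV\in(\operatorname{range}F_*)^\perp$. For a section $V$ of $(\operatorname{range}F_*)^\perp$ write $\nabla^F_XV=-\mathcal S_VF_*X+\nabla^{F\perp}_XV$ with $\mathcal S_VF_*X\in\operatorname{range}F_*$ and $\nabla^{F\perp}_XV\in(\operatorname{range}F_*)^\perp$. Consider the conditions (i) the fibres of $F$ are totally geodesic; (ii) the horizontal distribution $(\ker F_*)^\perp$ is totally geodesic, i.e. $\nabla^1_XY\in\Gamma((\ker F_*)^\perp)$ for all $X,Y\in\Gamma((\ker F_*)^\perp)$; (iii) for all $X,Y\in\Gamma((\ker F_*)^\perp)$ and $V\in\Gamma((\operatorname{range}F_*)^\perp)$, $$g_2(\mathcal S_{\omega F_*Y}F_*X,\mathcal BV)=g_2(\nabla^{F\perp}_X\omega F_*Y,\mathcal CV)-g_2(\nabla^{F\perp}_X\omega\phi F_*Y,V).$$ If $F$ is totally geodesic, then (i), (ii) and (iii) hold. Conversely, if $\theta\neq0$ and (i),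 (ii) and (iii) hold, then $F$ is totally geodesic. (So for $\theta\ne0$ the map $F$ is totally geodesic if and only if (i), (ii) and (iii) hold.) -/

import Mathlib

open Bundle Manifold FiberBundle
open scoped ContDiff InnerProductSpace

noncomputable section

namespace SlantGeom

instance instFiniteDimensionalTangentSpace {E H M : Type*} [NormedAddCommGroup E]
    [NormedSpace ℝ E] [FiniteDimensional ℝ E] [TopologicalSpace H] (I : ModelWithCorners ℝ E H)
    [TopologicalSpace M] [ChartedSpace H M] (x : M) : FiniteDimensional ℝ (TangentSpace I x) :=
  inferInstanceAs (FiniteDimensional ℝ E)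

section Connection

variable {E H M : Type*} [NormedAddCommGroup E] [NormedSpace ℝ E] [FiniteDimensional ℝ E]
  [TopologicalSpace H] {I : ModelWithCorners ℝ E H}
  [TopologicalSpace M] [ChartedSpace H M] [IsManifold I ∞ M]
  [RiemannianBundle (fun x : M ↦ TangentSpace I x)]

variable (I) in
/-- `X` is a smooth vector field on `M`, that is, `X ∈ Γ(TM)`. -/
def IsSmoothField (X : ∀ x : M, TangentSpace I x) : Prop :=
  ContMDiff I I.tangent ∞ (fun x ↦ (⟨x, X x⟩ : TangentBundle I M))

/-- Twice the Christoffel symbol of the first kind at `x`: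
`∂_v g(w, z) + ∂_w g(v, z) - ∂_z g(v, w)`, where the tangent vectors `v`, `w`, `z` at `x` are
extended near `x` to the vector fields with constant coefficients in the preferred chart at `x`
(this is what `FiberBundle.extend` does). -/
def christoffelFirst {x : M} (v w z : TangentSpace I x) : ℝ :=
  mvfderiv I (fun y ↦ ⟪extend E w y, extend E z y⟫_ℝ) x v
    + mvfderiv I (fun y ↦ ⟪extend E v y, extend E z y⟫_ℝ) x w
    - mvfderiv I (fun y ↦ ⟪extend E v y, extend E w y⟫_ℝ) x z

/-- The Christoffel symbol `Γ_x(v, w)` of the Riemannian metric in the preferred chart at `x`: the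
tangent vector with `2 g(Γ_x(v, w), z) = ∂_v g(w, z) + ∂_w g(v, z) - ∂_z g(v, w)` for all `z`. -/
def christoffel {x : M} (v w : TangentSpace I x) : TangentSpace I x :=
  ∑ i, ((1 / 2 : ℝ) * christoffelFirst v w (stdOrthonormalBasis ℝ (TangentSpace I x) i)) •
    stdOrthonormalBasis ℝ (TangentSpace I x) i

/-- The derivative in the direction `v` of the components of the vector field `Y` in the preferred
chart at `x`. -/
def coordDeriv (Y : ∀ x : M, TangentSpace I x) (x : M) (v : TangentSpace I x) :
    TangentSpace I x :=
  (trivializationAt E (TangentSpace I : M → Type _) x).symm x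
    (mvfderiv I (fun y ↦ (trivializationAt E (TangentSpace I : M → Type _) x ⟨y, Y y⟩).2) x v)

/-- The Levi-Civita connection, `leviCivita Y x v = (∇_v Y)(x)`: in the preferred chart at `x`,
`∇_v Y = ∂_v Y + Γ(v, Y)`. -/
def leviCivita (Y : ∀ x : M, TangentSpace I x) (x : M) (v : TangentSpace I x) :
    TangentSpace I x :=
  coordDeriv Y x v + christoffel v (Y x)

end Connection

section Maps

variable {E₁ H₁ M₁ : Type*} [NormedAddCommGroup E₁] [NormedSpace ℝ E₁] [FiniteDimensional ℝ E₁]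
  [TopologicalSpace H₁] (I₁ : ModelWithCorners ℝ E₁ H₁)
  [TopologicalSpace M₁] [ChartedSpace H₁ M₁] [IsManifold I₁ ∞ M₁]
  [RiemannianBundle (fun x : M₁ ↦ TangentSpace I₁ x)]
  {E₂ H₂ M₂ : Type*} [NormedAddCommGroup E₂] [NormedSpace ℝ E₂] [FiniteDimensional ℝ E₂]
  [TopologicalSpace H₂] (I₂ : ModelWithCorners ℝ E₂ H₂)
  [TopologicalSpace M₂] [ChartedSpace H₂ M₂] [IsManifold I₂ ∞ M₂]
  [RiemannianBundle (fun x : M₂ ↦ TangentSpace I₂ x)]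

/-- The vertical space `ker F_{*p}`. -/
def vertical (F : M₁ → M₂) (p : M₁) : Submodule ℝ (TangentSpace I₁ p) :=
  (mfderiv I₁ I₂ F p).ker

/-- The horizontal space `(ker F_{*p})^⊥`. -/
def horizontal (F : M₁ → M₂) (p : M₁) : Submodule ℝ (TangentSpace I₁ p) :=
  (vertical I₁ I₂ F p)ᗮ

/-- The space `range F_{*p}`. -/
def rangeSpace (F : M₁ → M₂) (p : M₁) : Submodule ℝ (TangentSpace I₂ (F p)) :=
  (mfderiv I₁ I₂ F p).range

/-- The normal space `(range F_{*p})^⊥`. -/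
def normalSpace (F : M₁ → M₂) (p : M₁) : Submodule ℝ (TangentSpace I₂ (F p)) :=
  (rangeSpace I₁ I₂ F p)ᗮ

/-- The component of `u` in `range F_{*p}`. -/
def tangentialPart (F : M₁ → M₂) (p : M₁) (u : TangentSpace I₂ (F p)) : TangentSpace I₂ (F p) :=
  (rangeSpace I₁ I₂ F p).starProjection u

/-- The component of `u` in `(range F_{*p})^⊥`. -/
def normalPart (F : M₁ → M₂) (p : M₁) (u : TangentSpace I₂ (F p)) : TangentSpace I₂ (F p) :=
  (normalSpace I₁ I₂ F p).starProjection u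

/-- `σ` is a smooth vector field along `F`, that is, a smooth section of the pullback bundle
`F⁻¹ TM₂`. -/
def IsSmoothAlong (F : M₁ → M₂) (σ : ∀ p : M₁, TangentSpace I₂ (F p)) : Prop :=
  ContMDiff I₁ I₂.tangent ∞ (fun p ↦ (⟨F p, σ p⟩ : TangentBundle I₂ M₂))

/-- The vector field `F_* Y` along `F`. -/
def pushforward (F : M₁ → M₂) (Y : ∀ p : M₁, TangentSpace I₁ p) (p : M₁) :
    TangentSpace I₂ (F p) :=
  mfderiv I₁ I₂ F p (Y p)

/-- The derivative in the direction `v` of the components of the vector field `σ` along `F` in the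
preferred chart at `F p`. -/
def coordDerivAlong (F : M₁ → M₂) (σ : ∀ p : M₁, TangentSpace I₂ (F p)) (p : M₁)
    (v : TangentSpace I₁ p) : TangentSpace I₂ (F p) :=
  (trivializationAt E₂ (TangentSpace I₂ : M₂ → Type _) (F p)).symm (F p)
    (mvfderiv I₁
      (fun q ↦ (trivializationAt E₂ (TangentSpace I₂ : M₂ → Type _) (F p) ⟨F q, σ q⟩).2) p v)

/-- The pullback along `F` of the Levi-Civita connection of `M₂`,
`pullbackConnection F σ p v = (∇^F_v σ)(p)`: in the preferred chart at `F p`,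
`∇^F_v σ = ∂_v σ + Γ(F_* v, σ)`. -/
def pullbackConnection (F : M₁ → M₂) (σ : ∀ p : M₁, TangentSpace I₂ (F p)) (p : M₁)
    (v : TangentSpace I₁ p) : TangentSpace I₂ (F p) :=
  coordDerivAlong I₁ I₂ F σ p v + christoffel (mfderiv I₁ I₂ F p v) (σ p)

/-- The second fundamental form `(∇F_*)(X, Y) = ∇^F_X F_* Y - F_* (∇_X Y)`. -/
def secondFundamentalForm (F : M₁ → M₂) (X Y : ∀ p : M₁, TangentSpace I₁ p) (p : M₁) :
    TangentSpace I₂ (F p) :=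
  pullbackConnection I₁ I₂ F (pushforward I₁ I₂ F Y) p (X p)
    - mfderiv I₁ I₂ F p (leviCivita Y p (X p))

/-- `F` is a totally geodesic map: `(∇F_*)(X, Y) = 0` for all `X, Y ∈ Γ(TM₁)`. -/
def IsTotallyGeodesicMap (F : M₁ → M₂) : Prop :=
  ∀ X Y : ∀ p : M₁, TangentSpace I₁ p, IsSmoothField I₁ X → IsSmoothField I₁ Y →
    ∀ p, secondFundamentalForm I₁ I₂ F X Y p = 0

/-- The normal connection `∇^{F⊥}_v V`: the normal component of `∇^F_v V`. -/
def normalConnection (F : M₁ → M₂) (V : ∀ p : M₁, TangentSpace I₂ (F p)) (p : M₁)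
    (v : TangentSpace I₁ p) : TangentSpace I₂ (F p) :=
  normalPart I₁ I₂ F p (pullbackConnection I₁ I₂ F V p v)

/-- The shape operator `S_V F_* v`: minus the tangential component of `∇^F_v V`, so that
`∇^F_v V = -S_V F_* v + ∇^{F⊥}_v V`. -/
def shapeOperator (F : M₁ → M₂) (V : ∀ p : M₁, TangentSpace I₂ (F p)) (p : M₁)
    (v : TangentSpace I₁ p) : TangentSpace I₂ (F p) :=
  -tangentialPart I₁ I₂ F p (pullbackConnection I₁ I₂ F V p v)

/-- `F` is a (smooth) Riemannian map: at each point, `F_*` is isometric on `(ker F_*)^⊥`. -/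
structure IsRiemannianMap (F : M₁ → M₂) : Prop where
  smooth : ContMDiff I₁ I₂ ∞ F
  isometric : ∀ p, ∀ v ∈ horizontal I₁ I₂ F p, ∀ w ∈ horizontal I₁ I₂ F p,
    ⟪mfderiv I₁ I₂ F p v, mfderiv I₁ I₂ F p w⟫_ℝ = ⟪v, w⟫_ℝ

/-- All fibres of `F` are totally geodesic. The tangent space at `x` of the fibre through `x` is
`ker F_{*x}`; the second fundamental form of a fibre is the normal component (along the fibre)
of `∇_U W` for vector fields `U`, `W` that are tangent to this fibre, and it has to vanish. -/
def FibresTotallyGeodesic (F : M₁ → M₂) : Prop :=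
  ∀ q : M₂, ∀ U W : ∀ p : M₁, TangentSpace I₁ p, IsSmoothField I₁ U → IsSmoothField I₁ W →
    (∀ x, F x = q → U x ∈ vertical I₁ I₂ F x ∧ W x ∈ vertical I₁ I₂ F x) →
    ∀ p, F p = q → leviCivita W p (U p) ∈ vertical I₁ I₂ F p

/-- The horizontal distribution `(ker F_*)^⊥` is totally geodesic: `∇_X Y` is horizontal for all
`X, Y ∈ Γ((ker F_*)^⊥)`. -/
def HorizontalTotallyGeodesic (F : M₁ → M₂) : Prop :=
  ∀ X Y : ∀ p : M₁, TangentSpace I₁ p, IsSmoothField I₁ X → IsSmoothField I₁ Y →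
    (∀ x, X x ∈ horizontal I₁ I₂ F x) → (∀ x, Y x ∈ horizontal I₁ I₂ F x) →
    ∀ p, leviCivita Y p (X p) ∈ horizontal I₁ I₂ F p

/-- `J` makes the Riemannian manifold `M₂` an almost Hermitian manifold. -/
structure IsAlmostHermitian (J : ∀ y : M₂, TangentSpace I₂ y →L[ℝ] TangentSpace I₂ y) :
    Prop where
  smooth : ContMDiff I₂ (I₂.prod 𝓘(ℝ, E₂ →L[ℝ] E₂)) ∞
    (fun y ↦ TotalSpace.mk' (E₂ →L[ℝ] E₂)
      (E := fun y : M₂ ↦ TangentSpace I₂ y →L[ℝ] TangentSpace I₂ y) y (J y))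
  sq : ∀ y v, J y (J y v) = -v
  inner_map : ∀ y v w, ⟪J y v, J y w⟫_ℝ = ⟪v, w⟫_ℝ

/-- `J` makes the Riemannian manifold `M₂` a Kähler manifold: it is almost Hermitian and
`(∇_X J) Y = ∇_X (J Y) - J (∇_X Y) = 0` for all `X, Y ∈ Γ(TM₂)`. -/
structure IsKaehler (J : ∀ y : M₂, TangentSpace I₂ y →L[ℝ] TangentSpace I₂ y) : Prop
    extends IsAlmostHermitian I₂ J where
  parallel : ∀ X Y : ∀ y : M₂, TangentSpace I₂ y, IsSmoothField I₂ X → IsSmoothField I₂ Y →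
    ∀ y, leviCivita (fun z ↦ J z (Y z)) y (X y) - J y (leviCivita Y y (X y)) = 0

variable (J : ∀ y : M₂, TangentSpace I₂ y →L[ℝ] TangentSpace I₂ y)

/-- `φ u`, the tangential part of `J u`, for `u ∈ range F_*`. -/
def phi (F : M₁ → M₂) (p : M₁) (u : TangentSpace I₂ (F p)) : TangentSpace I₂ (F p) :=
  tangentialPart I₁ I₂ F p (J (F p) u)

/-- `ω u`, the normal part of `J u`, for `u ∈ range F_*`. -/
def omega (F : M₁ → M₂) (p : M₁) (u : TangentSpace I₂ (F p)) : TangentSpace I₂ (F p) :=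
  normalPart I₁ I₂ F p (J (F p) u)

/-- `ℬ V`, the tangential part of `J V`, for `V ∈ (range F_*)^⊥`. -/
def calB (F : M₁ → M₂) (p : M₁) (V : TangentSpace I₂ (F p)) : TangentSpace I₂ (F p) :=
  tangentialPart I₁ I₂ F p (J (F p) V)

/-- `𝒞 V`, the normal part of `J V`, for `V ∈ (range F_*)^⊥`. -/
def calC (F : M₁ → M₂) (p : M₁) (V : TangentSpace I₂ (F p)) : TangentSpace I₂ (F p) :=
  normalPart I₁ I₂ F p (J (F p) V)

/-- The angle in `[0, π/2]` between the nonzero vector `J u` and the subspace `range F_{*p}`, that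
is, the angle between `J u` and its orthogonal projection `φ u` onto this subspace (Mathlib's
`InnerProductGeometry.angle` is `π/2` if this projection vanishes). -/
def slantAngle (F : M₁ → M₂) (p : M₁) (u : TangentSpace I₂ (F p)) : ℝ :=
  InnerProductGeometry.angle (J (F p) u) (phi I₁ I₂ J F p u)

/-- `F` is a slant Riemannian map with slant angle `θ`: a Riemannian map such that for every
nonzero horizontal vector `X` the angle between `J F_* X` and `range F_*` is `θ`. -/
structure IsSlantRiemannianMap (F : M₁ → M₂) (θ : ℝ) : Prop
    extends IsRiemannianMap I₁ I₂ F where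
  angle_eq : ∀ p, ∀ X ∈ horizontal I₁ I₂ F p, X ≠ 0 →
    slantAngle I₁ I₂ J F p (mfderiv I₁ I₂ F p X) = θ

/-- The identity
`g₂(S_{ω F_* Y} F_* X, ℬ V) = g₂(∇^{F⊥}_X ω F_* Y, 𝒞 V) - g₂(∇^{F⊥}_X ω φ F_* Y, V)`
for all `X, Y ∈ Γ((ker F_*)^⊥)` and `V ∈ Γ((range F_*)^⊥)`. -/
def SlantIdentity (F : M₁ → M₂) : Prop :=
  ∀ X Y : ∀ p : M₁, TangentSpace I₁ p, IsSmoothField I₁ X → IsSmoothField I₁ Y →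
    (∀ x, X x ∈ horizontal I₁ I₂ F x) → (∀ x, Y x ∈ horizontal I₁ I₂ F x) →
    ∀ V : ∀ p : M₁, TangentSpace I₂ (F p), IsSmoothAlong I₁ I₂ F V →
    (∀ x, V x ∈ normalSpace I₁ I₂ F x) →
    ∀ p,
      ⟪shapeOperator I₁ I₂ F
          (fun q ↦ omega I₁ I₂ J F q (pushforward I₁ I₂ F Y q)) p (X p),
        calB I₁ I₂ J F p (V p)⟫_ℝ
      = ⟪normalConnection I₁ I₂ F
          (fun q ↦ omega I₁ I₂ J F q (pushforward I₁ I₂ F Y q)) p (X p),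
        calC I₁ I₂ J F p (V p)⟫_ℝ
      - ⟪normalConnection I₁ I₂ F
          (fun q ↦ omega I₁ I₂ J F q (phi I₁ I₂ J F q (pushforward I₁ I₂ F Y q))) p (X p),
        V p⟫_ℝ

end Maps

/- Checks of the definitions: `leviCivita` is a covariant derivative that is compatible with the
metric and torsion free, and `pullbackConnection` is the pullback of it. -/

section LeviCivita

set_option linter.unusedSectionVars false

variable {E H M : Type*} [NormedAddCommGroup E] [NormedSpace ℝ E] [FiniteDimensional ℝ E]
  [TopologicalSpace H] {I : ModelWithCorners ℝ E H}
  [TopologicalSpace M] [ChartedSpace H M] [IsManifold I ∞ M]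
  [RiemannianBundle (fun x : M ↦ TangentSpace I x)]

variable [IsContMDiffRiemannianBundle I ∞ E (fun x : M ↦ TangentSpace I x)]

lemma eventually_mem_baseSet (x : M) : ∀ᶠ y in nhds x, y ∈ (trivializationAt E (TangentSpace I : M → Type _) x).baseSet :=
  (trivializationAt E (TangentSpace I : M → Type _) x).open_baseSet.mem_nhds (mem_baseSet_trivializationAt E (TangentSpace I : M → Type _) x)

lemma mvfderiv_congr_eventually {G : Type*} [NormedAddCommGroup G] [NormedSpace ℝ G] {f g : M → G} {x : M} (h : f =ᶠ[nhds x] g) : mvfderiv I f x = mvfderiv I g x := by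
  ext v
  have := h.mfderiv_eq (I := I) (I' := 𝓘(ℝ, G))
  simp only [mvfderiv, this]
  rfl

lemma symm_add_of_mem {x y : M} (hy : y ∈ (trivializationAt E (TangentSpace I : M → Type _) x).baseSet) (a b : E) :
   (trivializationAt E (TangentSpace I : M → Type _) x).symm y (a+b) = (trivializationAt E (TangentSpace I : M → Type _) x).symm y a + (trivializationAt E (TangentSpace I : M → Type _) x).symm y b := by
  have := ((trivializationAt E (TangentSpace I : M → Type _) x).symmₗ ℝ y).map_add a b
  rwa [Trivialization.coe_symmₗ (R := ℝ) (e := (trivializationAt E (TangentSpace I : M → Type _) x)) hy] at this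

lemma symm_smul_of_mem {x y : M} (hy : y ∈ (trivializationAt E (TangentSpace I : M → Type _) x).baseSet) (c : ℝ) (b : E) :
   (trivializationAt E (TangentSpace I : M → Type _) x).symm y (c • b) = c • (trivializationAt E (TangentSpace I : M → Type _) x).symm y b := by
  have := ((trivializationAt E (TangentSpace I : M → Type _) x).symmₗ ℝ y).map_smul c b
  rwa [Trivialization.coe_symmₗ (R := ℝ) (e := (trivializationAt E (TangentSpace I : M → Type _) x)) hy] at this

lemma extend_add_of_mem {x : M} (v w : TangentSpace I x) (y : M) (hy : y ∈ (trivializationAt E (TangentSpace I : M → Type _) x).baseSet) :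
    extend E (v + w) y = extend E v y + extend E w y := by
  have h := (trivializationAt E (TangentSpace I : M → Type _) x).linear ℝ
    (mem_baseSet_trivializationAt E (TangentSpace I : M → Type _) x)
  simp only [extend]
  rw [h.map_add]
  exact symm_add_of_mem hy _ _

lemma extend_smul_of_mem {x : M} (c : ℝ) (v : TangentSpace I x) (y : M) (hy : y ∈ (trivializationAt E (TangentSpace I : M → Type _) x).baseSet) :
    extend E (c • v) y = c • extend E v y := by
  have h := (trivializationAt E (TangentSpace I : M → Type _) x).linear ℝ
    (mem_baseSet_trivializationAt E (TangentSpace I : M → Type _) x)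
  simp only [extend]
  rw [h.map_smul]
  exact symm_smul_of_mem hy _ _

lemma mdifferentiableAt_inner_extend {x : M} (v w : TangentSpace I x) :
    MDifferentiableAt I 𝓘(ℝ, ℝ) (fun y ↦ ⟪extend E v y, extend E w y⟫_ℝ) x :=
  MDifferentiableAt.inner_bundle (IB := I) (F := E) (E := fun x : M ↦ TangentSpace I x)
    (mdifferentiableAt_extend I E v) (mdifferentiableAt_extend I E w)

/-- The derivative at `x` in the direction `u` of the metric coefficient `g(v, w)` in the preferred
chart at `x`. -/
def derivMetricCoeff {x : M} (u v w : TangentSpace I x) : ℝ :=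
  mvfderiv I (fun y ↦ ⟪extend E v y, extend E w y⟫_ℝ) x u

lemma derivMetricCoeff_add {x : M} (u v v' w : TangentSpace I x) : derivMetricCoeff u (v+v') w = derivMetricCoeff u v w + derivMetricCoeff u v' w := by
  have e : (fun y ↦ ⟪extend E (v+v') y, extend E w y⟫_ℝ) =ᶠ[nhds x] (fun y ↦ ⟪extend E v y, extend E w y⟫_ℝ) + (fun y ↦ ⟪extend E v' y, extend E w y⟫_ℝ) := by
    filter_upwards [eventually_mem_baseSet (I := I) x] with y hy
    simp only [extend_add_of_mem _ _ _ hy, inner_add_left]; rfl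
  simp only [derivMetricCoeff]
  rw [mvfderiv_congr_eventually e, mvfderiv_add (mdifferentiableAt_inner_extend _ _) (mdifferentiableAt_inner_extend _ _)]; rfl

lemma derivMetricCoeff_smul {x : M} (c : ℝ) (u v w : TangentSpace I x) : derivMetricCoeff u (c • v) w = c * derivMetricCoeff u v w := by
  have e : (fun y ↦ ⟪extend E (c • v) y, extend E w y⟫_ℝ) =ᶠ[nhds x] (fun _ : M ↦ c) • (fun y ↦ ⟪extend E v y, extend E w y⟫_ℝ) := by
    filter_upwards [eventually_mem_baseSet (I := I) x] with y hy
    simp only [extend_smul_of_mem _ _ _ hy, real_inner_smul_left]; rfl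
  simp only [derivMetricCoeff]
  rw [mvfderiv_congr_eventually e, mvfderiv_smul (I := I) (x := x) (a := fun _ ↦ c) mdifferentiableAt_const (mdifferentiableAt_inner_extend v w)]
  have h3 : mvfderiv I (fun _ : M ↦ c) x = 0 := by rw [mvfderiv_const]
  rw [h3]; simp

lemma derivMetricCoeff_symm {x : M} (u v w : TangentSpace I x) : derivMetricCoeff u v w = derivMetricCoeff u w v := by
  simp only [derivMetricCoeff, real_inner_comm]

lemma christoffelFirst_eq {x : M} (u v w : TangentSpace I x) :
  christoffelFirst u v w = derivMetricCoeff u v w + derivMetricCoeff v u w - derivMetricCoeff w u v := rfl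

lemma two_mul_inner_christoffel {x : M} (v w z : TangentSpace I x) :
    2 * ⟪christoffel v w, z⟫_ℝ = christoffelFirst v w z := by
  let φ : TangentSpace I x →ₗ[ℝ] ℝ :=
    { toFun := christoffelFirst v w
      map_add' := fun a b ↦ by
        simp only [christoffelFirst_eq]; rw [derivMetricCoeff_symm v w, derivMetricCoeff_add, derivMetricCoeff_symm v a, derivMetricCoeff_symm v b, derivMetricCoeff_symm w v, derivMetricCoeff_add,
          derivMetricCoeff_symm w a, derivMetricCoeff_symm w b]; simp only [derivMetricCoeff, map_add]; ring
      map_smul' := fun c a ↦ by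
        simp only [christoffelFirst_eq]; rw [derivMetricCoeff_symm v w, derivMetricCoeff_smul, derivMetricCoeff_symm v a, derivMetricCoeff_symm w v, derivMetricCoeff_smul,
          derivMetricCoeff_symm w a]; simp only [derivMetricCoeff, map_smul, smul_eq_mul, RingHom.id_apply]; ring }
  have : christoffelFirst v w z = φ z := rfl
  rw [this, ← (stdOrthonormalBasis ℝ (TangentSpace I x)).sum_repr' z, map_sum, christoffel,
    sum_inner, Finset.mul_sum]
  refine Finset.sum_congr rfl fun i _ ↦ ?_
  rw [(stdOrthonormalBasis ℝ (TangentSpace I x)).sum_repr' z, map_smul, inner_smul_left]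
  simp [φ]; ring

lemma christoffel_symm {x : M} (v w : TangentSpace I x) : christoffel v w = christoffel w v := by
  refine ext_inner_right ℝ fun z ↦ ?_
  have h1 := two_mul_inner_christoffel v w z; have h2 := two_mul_inner_christoffel w v z
  rw [christoffelFirst_eq] at h1 h2; rw [derivMetricCoeff_symm z v w] at h1; linarith

lemma derivMetricCoeff_eq_christoffel {x : M} (u v w : TangentSpace I x) :
   derivMetricCoeff u v w = ⟪christoffel u v, w⟫_ℝ + ⟪v, christoffel u w⟫_ℝ := by
  have h1 := two_mul_inner_christoffel u v w; have h2 := two_mul_inner_christoffel u w v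
  rw [christoffelFirst_eq] at h1 h2; rw [derivMetricCoeff_symm u w v] at h2; rw [real_inner_comm _ v]
  rw [derivMetricCoeff_symm w u v, derivMetricCoeff_symm v u w] at *
  linarith

lemma christoffel_add_left {x : M} (u u' v : TangentSpace I x) :
    christoffel (u + u') v = christoffel u v + christoffel u' v := by
  refine ext_inner_right ℝ fun z ↦ ?_
  have h0 := two_mul_inner_christoffel (u+u') v z; have h1 := two_mul_inner_christoffel u v z; have h2 := two_mul_inner_christoffel u' v z
  rw [christoffelFirst_eq] at h0 h1 h2
  rw [inner_add_left]
  have a1 : derivMetricCoeff (u+u') v z = derivMetricCoeff u v z + derivMetricCoeff u' v z := by simp [derivMetricCoeff]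
  rw [a1, derivMetricCoeff_add, derivMetricCoeff_add] at h0
  linarith

lemma christoffel_smul_left {x : M} (c : ℝ) (u v : TangentSpace I x) :
    christoffel (c • u) v = c • christoffel u v := by
  refine ext_inner_right ℝ fun z ↦ ?_
  have h0 := two_mul_inner_christoffel (c • u) v z; have h1 := two_mul_inner_christoffel u v z
  rw [christoffelFirst_eq] at h0 h1
  rw [inner_smul_left]
  have a1 : derivMetricCoeff (c • u) v z = c * derivMetricCoeff u v z := by simp [derivMetricCoeff]
  rw [a1, derivMetricCoeff_smul, derivMetricCoeff_smul] at h0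
  simp; linear_combination h0/2 - c * h1 /2

/-- The Levi-Civita connection as a continuous linear map in the direction. -/
def leviCivitaCLM (Y : ∀ x : M, TangentSpace I x) (x : M) :
    TangentSpace I x →L[ℝ] TangentSpace I x :=
  LinearMap.toContinuousLinearMap
  { toFun := leviCivita Y x
    map_add' := fun u v ↦ by
      simp only [leviCivita, coordDeriv, christoffel_add_left, map_add]
      rw [symm_add_of_mem (mem_baseSet_trivializationAt E (TangentSpace I : M → Type _) x)]
      abel
    map_smul' := fun c u ↦ by
      simp only [leviCivita, coordDeriv, christoffel_smul_left, map_smul]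
      rw [symm_smul_of_mem (mem_baseSet_trivializationAt E (TangentSpace I : M → Type _) x)]
      simp }

lemma leviCivitaCLM_apply (Y : ∀ x : M, TangentSpace I x) (x : M) (v : TangentSpace I x) :
   leviCivitaCLM Y x v = leviCivita Y x v := rfl

lemma mdifferentiableAt_coord {Y : ∀ x : M, TangentSpace I x} {x : M} 
   (hY : MDifferentiableAt I I.tangent (fun y ↦ (⟨y, Y y⟩ : TangentBundle I M)) x) :
   MDifferentiableAt I 𝓘(ℝ, E) (fun y ↦ (trivializationAt E (TangentSpace I : M → Type _) x ⟨y, Y y⟩).2) x := by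
  have := (mdifferentiableAt_totalSpace (IB := I) _ ).1 hY
  exact this.2

/-- The Levi-Civita connection as a covariant derivative. -/
def leviCivitaCov : CovariantDerivative I E (TangentSpace I : M → Type _) where
  toFun := fun Y x ↦ leviCivitaCLM (I := I) Y x
  isCovariantDerivativeOnUniv :=
  { add := fun {Y Z x} hY hZ _ ↦ by
      ext v
      simp only [leviCivitaCLM_apply, add_apply, leviCivita, coordDeriv, Pi.add_apply]
      have e : (fun y ↦ (trivializationAt E (TangentSpace I : M → Type _) x ⟨y, Y y + Z y⟩).2)
        =ᶠ[nhds x] (fun y ↦ (trivializationAt E (TangentSpace I : M → Type _) x ⟨y, Y y⟩).2 + (trivializationAt E (TangentSpace I : M → Type _) x ⟨y, Z y⟩).2) := by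
        filter_upwards [eventually_mem_baseSet (I := I) x] with y hy
        exact ((trivializationAt E (TangentSpace I : M → Type _) x).linear ℝ hy).map_add _ _
      rw [mvfderiv_congr_eventually e, ]
      have := mvfderiv_add (mdifferentiableAt_coord hY) (mdifferentiableAt_coord hZ)
      have h2 := congrArg (fun L ↦ L v) this
      simp only [add_apply] at h2
      erw [h2]
      rw [christoffel_symm v, christoffel_add_left, christoffel_symm (Y x), christoffel_symm (Z x)]
      rw [symm_add_of_mem (mem_baseSet_trivializationAt E (TangentSpace I : M → Type _) x)]
      abel
    leibniz := fun {Y g x} hY hg _ ↦ by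
      ext v
      have e : (fun y ↦ (trivializationAt E (TangentSpace I : M → Type _) x ⟨y, (g • Y) y⟩).2)
        =ᶠ[nhds x] (fun y ↦ g y • (trivializationAt E (TangentSpace I : M → Type _) x ⟨y, Y y⟩).2) := by
        filter_upwards [eventually_mem_baseSet (I := I) x] with y hy
        exact ((trivializationAt E (TangentSpace I : M → Type _) x).linear ℝ hy).map_smul _ _
      simp only [leviCivitaCLM_apply, add_apply, leviCivita, coordDeriv]
      rw [mvfderiv_congr_eventually e]
      have := mvfderiv_smul hg (mdifferentiableAt_coord hY)
      have h2 := congrArg (fun L ↦ L v) this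
      simp only [add_apply] at h2
      erw [h2]
      simp only [Pi.smul_apply']
      rw [christoffel_symm v, christoffel_smul_left, christoffel_symm (Y x)]
      rw [symm_add_of_mem (mem_baseSet_trivializationAt E (TangentSpace I : M → Type _) x)]
      simp only [smul_apply, ContinuousLinearMap.smulRight_apply]
      rw [symm_smul_of_mem (mem_baseSet_trivializationAt E (TangentSpace I : M → Type _) x),symm_smul_of_mem (mem_baseSet_trivializationAt E (TangentSpace I : M → Type _) x)]
      rw [(trivializationAt E (TangentSpace I : M → Type _) x).symm_apply_apply_mk (mem_baseSet_trivializationAt E (TangentSpace I : M → Type _) x)]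
      simp only [leviCivitaCLM_apply, leviCivita, coordDeriv, smul_add]
      abel }

lemma leviCivita_extend {x : M} (v w : TangentSpace I x) : leviCivita (extend E w) x v = christoffel v w := by
  simp only [leviCivita, coordDeriv, extend_apply_self]
  have e : (fun y ↦ (trivializationAt E (TangentSpace I : M → Type _) x ⟨y, extend E w y⟩).2)
        =ᶠ[nhds x] (fun _ ↦ (trivializationAt E (TangentSpace I : M → Type _) x ⟨x, w⟩).2) := by
    filter_upwards [eventually_mem_baseSet (I := I) x] with y hy
    simp only [extend]
    exact congrArg Prod.snd (a₂ := (y, (trivializationAt E (TangentSpace I : M → Type _) x ⟨x, w⟩).2)) ((trivializationAt E (TangentSpace I : M → Type _) x).apply_mk_symm hy _)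
  rw [mvfderiv_congr_eventually e, mvfderiv_const]
  have : (trivializationAt E (TangentSpace I : M → Type _) x).symm x (0:E) = 0 := by
    have := symm_smul_of_mem (I := I) (mem_baseSet_trivializationAt E (TangentSpace I : M → Type _) x) 0 0
    simpa using this
  erw [this]; simp

/-- The Levi-Civita connection is compatible with the metric. -/
theorem leviCivitaCov_isMetricCompatible : CovariantDerivative.IsMetricCompatible (I := I) (F := E) (V := fun x : M ↦ TangentSpace I x) leviCivitaCov := by
  ext x v w u
  rw [CovariantDerivative.derivMetricTensor_apply_eq_extend]
  have h := derivMetricCoeff_eq_christoffel u v w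
  have h1 : (leviCivitaCov (I := I) (M := M)).toFun (extend E v) x u = christoffel u v := leviCivita_extend u v
  have h2 : (leviCivitaCov (I := I) (M := M)).toFun (extend E w) x u = christoffel u w := leviCivita_extend u w
  rw [derivMetricCoeff] at h
  erw [h1, h2]
  rw [h]; simp

open VectorField in
lemma mpullbackWithin_extend [I.Boundaryless] {x : M} (v : TangentSpace I x) :
    mpullbackWithin 𝓘(ℝ, E) I (extChartAt I x).symm (extend E v) (Set.range I)
     =ᶠ[nhds (extChartAt I x x)] fun _ ↦ (trivializationAt E (TangentSpace I : M → Type _) x ⟨x, v⟩).2 := by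
  filter_upwards [extChartAt_target_mem_nhds (I := I) x] with u hu
  have hb : (extChartAt I x).symm u ∈ (chartAt H x).source := by
    have := (extChartAt I x).map_target hu
    rwa [extChartAt_source] at this
  have h := TangentBundle.symmL_trivializationAt (I := I) hb
  have hi := isInvertible_mfderivWithin_extChartAt_symm (I := I) hu
  rw [(extChartAt I x).right_inv hu] at h
  rw [mpullbackWithin_apply, ← h]
  rw [← h] at hi
  obtain ⟨L, hL⟩ := hi
  rw [← hL, ContinuousLinearMap.inverse_equiv]
  apply (ContinuousLinearEquiv.symm_apply_eq L).2
  have h2 := congrArg (fun K ↦ K (trivializationAt E (TangentSpace I : M → Type _) x ⟨x, v⟩).2) hL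
  refine Eq.trans ?_ h2.symm
  exact (Trivialization.symmL_apply (R := ℝ) (e := trivializationAt E (TangentSpace I : M → Type _) x) (hb := hb) (y := _)).symm

open VectorField in
lemma mlieBracket_extend [I.Boundaryless] {x : M} (v w : TangentSpace I x) : mlieBracket I (extend E v) (extend E w) x = 0 := by
  rw [← mlieBracketWithin_univ, mlieBracketWithin_apply]
  have : lieBracketWithin ℝ (mpullbackWithin 𝓘(ℝ, E) I (extChartAt I x).symm (extend E v) (Set.range I)) (mpullbackWithin 𝓘(ℝ, E) I (extChartAt I x).symm (extend E w) (Set.range I)) ((extChartAt I x).symm ⁻¹' Set.univ ∩ Set.range I) (extChartAt I x x) = 0 := by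
    rw [Filter.EventuallyEq.lieBracketWithin_vectorField_eq_of_mem ((mpullbackWithin_extend v).filter_mono nhdsWithin_le_nhds) ((mpullbackWithin_extend w).filter_mono nhdsWithin_le_nhds) (by simp [I.range_eq_univ])]
    simp [lieBracketWithin]
  erw [this]; exact map_zero _

/-- The Levi-Civita connection is torsion free. -/
theorem leviCivitaCov_torsion [I.Boundaryless] : (leviCivitaCov (I := I) (M := M)).torsion = 0 := by
  ext x v w
  rw [CovariantDerivative.torsion_apply_eq_extend]
  simp only [extend_apply_self]
  have h1 : (leviCivitaCov (I := I) (M := M)).toFun (extend E w) x v = christoffel v w := leviCivita_extend _ _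
  have h2 : (leviCivitaCov (I := I) (M := M)).toFun (extend E v) x w = christoffel w v := leviCivita_extend _ _
  erw [h1, h2]; rw [mlieBracket_extend, christoffel_symm]; simp

end LeviCivita

section Pullback

set_option linter.unusedSectionVars false

variable {E₁ H₁ M₁ : Type*} [NormedAddCommGroup E₁] [NormedSpace ℝ E₁] [FiniteDimensional ℝ E₁]
  [TopologicalSpace H₁] (I₁ : ModelWithCorners ℝ E₁ H₁)
  [TopologicalSpace M₁] [ChartedSpace H₁ M₁] [IsManifold I₁ ∞ M₁]
  [RiemannianBundle (fun x : M₁ ↦ TangentSpace I₁ x)]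
  {E₂ H₂ M₂ : Type*} [NormedAddCommGroup E₂] [NormedSpace ℝ E₂] [FiniteDimensional ℝ E₂]
  [TopologicalSpace H₂] (I₂ : ModelWithCorners ℝ E₂ H₂)
  [TopologicalSpace M₂] [ChartedSpace H₂ M₂] [IsManifold I₂ ∞ M₂]
  [RiemannianBundle (fun x : M₂ ↦ TangentSpace I₂ x)]
  [IsContMDiffRiemannianBundle I₂ ∞ E₂ (fun x : M₂ ↦ TangentSpace I₂ x)]

/-- The pullback connection is characterized by `∇^F_v (Y ∘ F) = ∇_{F_* v} Y`. -/
theorem pullbackConnection_comp {F : M₁ → M₂} {p : M₁} (hF : MDifferentiableAt I₁ I₂ F p)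
    {Y : ∀ y : M₂, TangentSpace I₂ y}
    (hY : MDifferentiableAt I₂ I₂.tangent (fun y ↦ (⟨y, Y y⟩ : TangentBundle I₂ M₂)) (F p))
    (v : TangentSpace I₁ p) :
    pullbackConnection I₁ I₂ F (fun q ↦ Y (F q)) p v = leviCivita Y (F p) (mfderiv I₁ I₂ F p v) := by
  have h := mfderiv_comp_apply p (mdifferentiableAt_coord hY) hF v
  exact congrArg (fun w : E₂ ↦
    (trivializationAt E₂ (TangentSpace I₂ : M₂ → Type _) (F p)).symm (F p) w
      + christoffel (mfderiv I₁ I₂ F p v) (Y (F p))) h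

end Pullback

end SlantGeom

end

noncomputable section

namespace SlantGeom

open scoped Topology

set_option linter.unusedSectionVars false

/-! ### Extending tangent vectors to global smooth vector fields -/

section Extension

variable {E H M : Type*} [NormedAddCommGroup E] [NormedSpace ℝ E] [FiniteDimensional ℝ E]
  [TopologicalSpace H] {I : ModelWithCorners ℝ E H}
  [TopologicalSpace M] [ChartedSpace H M] [IsManifold I ∞ M]
  [RiemannianBundle (fun x : M ↦ TangentSpace I x)]
  [IsContMDiffRiemannianBundle I ∞ E (fun x : M ↦ TangentSpace I x)]

/-! Write `B` for the second fundamental form of `F`. It is tensorial, and it is symmetric: in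
charts it consists of the second derivative of `F` and Christoffel terms, which are symmetric too
(`secondFundamentalForm_symm`). Hence `F` is totally geodesic as soon as `B` vanishes on pairs of
fields that are both horizontal, horizontal and vertical, or both vertical.

If `U` is vertical, then `F_* U = 0`, so `B(X, U) = -F_*(∇_X U)` and `B(X, U) = 0` means that `∇_X
U` is vertical. For vertical `X` this is condition (i). For horizontal `X` it is condition (ii),
because `g(∇_X Y, U) = -g(Y, ∇_X U)` for horizontal `Y`. One point needs care: (i) speaks of fields
tangent to a single fibre, not of globally vertical ones. The two versions are reconciled by a curve
that runs inside the fibre (`IsRiemannianMap.exists_curve_in_fibre`).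

For horizontal `X`, `Y`, `Z` the number `g₂(B(X, Y), F_* Z)` is symmetric in `X`, `Y` and skew in
`Y`, `Z`, hence zero; so `B(X, Y)` is normal. Its normal component comes from the slant condition:
`φ² = -cos² θ` on the range (`IsSlantRiemannianMap.phi_phi`) and `J` is parallel, which makes `sin²
θ · g₂(B(X, Y), V)` equal to the right side minus the left side of (iii)
(`IsSlantRiemannianMap.sin_sq_mul_inner_pullbackConnection`). So (iii) always follows from `B = 0`,
and it forces the normal component to vanish when `sin θ ≠ 0`. For `θ ≠ 0` the latter holds unless
`F_*` is zero everywhere, and in that case `B = 0` trivially.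

The pointwise arguments need global smooth horizontal, vertical and normal fields with prescribed
values. Smoothness of the projections is read off from inner products (`isSmoothField_of_inner`),
without a discussion of the rank of `F`. -/

lemma IsSmoothField.mdifferentiableAt {Y : ∀ x : M, TangentSpace I x} (hY : IsSmoothField I Y)
    (x : M) : MDifferentiableAt I I.tangent (fun y ↦ (⟨y, Y y⟩ : TangentBundle I M)) x :=
  (hY x).mdifferentiableAt (by simp)

/-- A tangent vector extends to a global smooth vector field with constant coefficients near the
base point. -/
lemma exists_isSmoothField_eventually_eq_extend [T2Space M] {x : M} (v : TangentSpace I x) :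
    ∃ Y : ∀ y : M, TangentSpace I y, IsSmoothField I Y ∧ ∀ᶠ y in 𝓝 x, Y y = extend E v y := by
  obtain ⟨ψ⟩ : Nonempty (SmoothBumpFunction I x) := inferInstance
  have hs : ContMDiffOn I I.tangent ∞
      (fun y ↦ (⟨y, extend E v y⟩ : TangentBundle I M))
      (trivializationAt E (TangentSpace I : M → Type _) x).baseSet := by
    intro y hy
    refine ((trivializationAt E (TangentSpace I : M → Type _) x).contMDiffWithinAt_section _ hy).2 ?_
    have h : ∀ z ∈ (trivializationAt E (TangentSpace I : M → Type _) x).baseSet,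
        (trivializationAt E (TangentSpace I : M → Type _) x ⟨z, extend E v z⟩).2
          = (trivializationAt E (TangentSpace I : M → Type _) x ⟨x, v⟩).2 := fun z hz ↦
      congrArg Prod.snd (a₂ := (z, (trivializationAt E (TangentSpace I : M → Type _) x ⟨x, v⟩).2))
        ((trivializationAt E (TangentSpace I : M → Type _) x).apply_mk_symm hz _)
    exact contMDiffWithinAt_const.congr h (h y hy)
  -- `extend E v` is smooth only over the chart domain; the bump function is `1` near `x` and has
  -- its support there.
  refine ⟨(ψ : M → ℝ) • extend E v, ?_, ?_⟩
  · exact ContMDiffOn.smul_section_of_tsupport ψ.contMDiff.contMDiffOn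
      (trivializationAt E (TangentSpace I : M → Type _) x).open_baseSet
      ψ.tsupport_subset_chartAt_source hs
  · filter_upwards [ψ.eventuallyEq_one] with y hy
    simp [hy]

lemma exists_isSmoothField_apply_eq [T2Space M] {x : M} (v : TangentSpace I x) :
    ∃ Y : ∀ y : M, TangentSpace I y, IsSmoothField I Y ∧ Y x = v := by
  obtain ⟨Y, hY, h⟩ := exists_isSmoothField_eventually_eq_extend v
  exact ⟨Y, hY, by rw [h.self_of_nhds, extend_apply_self]⟩

end Extension

/-! ### Vector fields along a map -/

section Along

variable {E₁ H₁ M₁ : Type*} [NormedAddCommGroup E₁] [NormedSpace ℝ E₁] [FiniteDimensional ℝ E₁]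
  [TopologicalSpace H₁] (I₁ : ModelWithCorners ℝ E₁ H₁)
  [TopologicalSpace M₁] [ChartedSpace H₁ M₁] [IsManifold I₁ ∞ M₁]
  [RiemannianBundle (fun x : M₁ ↦ TangentSpace I₁ x)]
  [IsContMDiffRiemannianBundle I₁ ∞ E₁ (fun x : M₁ ↦ TangentSpace I₁ x)]
  {E₂ H₂ M₂ : Type*} [NormedAddCommGroup E₂] [NormedSpace ℝ E₂] [FiniteDimensional ℝ E₂]
  [TopologicalSpace H₂] (I₂ : ModelWithCorners ℝ E₂ H₂)
  [TopologicalSpace M₂] [ChartedSpace H₂ M₂] [IsManifold I₂ ∞ M₂]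
  [RiemannianBundle (fun x : M₂ ↦ TangentSpace I₂ x)]
  [IsContMDiffRiemannianBundle I₂ ∞ E₂ (fun x : M₂ ↦ TangentSpace I₂ x)]

/-- The vector field `σ` along `F` is differentiable at `p`. -/
def MDifferentiableAlongAt (F : M₁ → M₂) (σ : ∀ p : M₁, TangentSpace I₂ (F p)) (p : M₁) : Prop :=
  MDifferentiableAt I₁ I₂.tangent (fun q ↦ (⟨F q, σ q⟩ : TangentBundle I₂ M₂)) p

variable {I₁ I₂} {F : M₁ → M₂} {σ τ : ∀ p : M₁, TangentSpace I₂ (F p)} {p : M₁}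

lemma IsSmoothAlong.mdifferentiableAlongAt (h : IsSmoothAlong I₁ I₂ F σ) (p : M₁) :
    MDifferentiableAlongAt I₁ I₂ F σ p :=
  (h p).mdifferentiableAt (by simp)

lemma mdifferentiableAlongAt_iff : MDifferentiableAlongAt I₁ I₂ F σ p ↔
    MDifferentiableAt I₁ I₂ F p ∧ MDifferentiableAt I₁ 𝓘(ℝ, E₂)
      (fun q ↦ (trivializationAt E₂ (TangentSpace I₂ : M₂ → Type _) (F p) ⟨F q, σ q⟩).2) p :=
  mdifferentiableAt_totalSpace _ _

lemma isSmoothAlong_iff : IsSmoothAlong I₁ I₂ F σ ↔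
    ∀ p, ContMDiffAt I₁ I₂ ∞ F p ∧ ContMDiffAt I₁ 𝓘(ℝ, E₂) ∞
      (fun q ↦ (trivializationAt E₂ (TangentSpace I₂ : M₂ → Type _) (F p) ⟨F q, σ q⟩).2) p :=
  forall_congr' fun _ ↦ contMDiffAt_totalSpace

lemma eventually_mem_baseSet_of_continuousAt (hF : ContinuousAt F p) : ∀ᶠ q in 𝓝 p,
    F q ∈ (trivializationAt E₂ (TangentSpace I₂ : M₂ → Type _) (F p)).baseSet :=
  hF.eventually (eventually_mem_baseSet (F p))

lemma coord_add_eventuallyEq (hF : ContinuousAt F p) :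
    (fun q ↦ (trivializationAt E₂ (TangentSpace I₂ : M₂ → Type _) (F p) ⟨F q, σ q + τ q⟩).2)
      =ᶠ[𝓝 p]
    (fun q ↦ (trivializationAt E₂ (TangentSpace I₂ : M₂ → Type _) (F p) ⟨F q, σ q⟩).2
      + (trivializationAt E₂ (TangentSpace I₂ : M₂ → Type _) (F p) ⟨F q, τ q⟩).2) := by
  filter_upwards [eventually_mem_baseSet_of_continuousAt (I₂ := I₂) hF] with q hq
  exact ((trivializationAt E₂ (TangentSpace I₂ : M₂ → Type _) (F p)).linear ℝ hq).map_add _ _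

lemma coord_smul_eventuallyEq (hF : ContinuousAt F p) (f : M₁ → ℝ) :
    (fun q ↦ (trivializationAt E₂ (TangentSpace I₂ : M₂ → Type _) (F p) ⟨F q, f q • σ q⟩).2)
      =ᶠ[𝓝 p]
    (fun q ↦ f q • (trivializationAt E₂ (TangentSpace I₂ : M₂ → Type _) (F p) ⟨F q, σ q⟩).2) := by
  filter_upwards [eventually_mem_baseSet_of_continuousAt (I₂ := I₂) hF] with q hq
  exact ((trivializationAt E₂ (TangentSpace I₂ : M₂ → Type _) (F p)).linear ℝ hq).map_smul _ _

lemma MDifferentiableAlongAt.congr (hσ : MDifferentiableAlongAt I₁ I₂ F σ p)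
    (h : ∀ᶠ q in 𝓝 p, τ q = σ q) : MDifferentiableAlongAt I₁ I₂ F τ p := by
  refine MDifferentiableAt.congr_of_eventuallyEq hσ ?_
  filter_upwards [h] with q hq
  rw [hq]

lemma MDifferentiableAlongAt.add (hσ : MDifferentiableAlongAt I₁ I₂ F σ p)
    (hτ : MDifferentiableAlongAt I₁ I₂ F τ p) :
    MDifferentiableAlongAt I₁ I₂ F (fun q ↦ σ q + τ q) p := by
  rw [mdifferentiableAlongAt_iff] at *
  exact ⟨hσ.1, (hσ.2.add hτ.2).congr_of_eventuallyEq
    (coord_add_eventuallyEq hσ.1.continuousAt)⟩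

lemma MDifferentiableAlongAt.smul {f : M₁ → ℝ} (hf : MDifferentiableAt I₁ 𝓘(ℝ, ℝ) f p)
    (hσ : MDifferentiableAlongAt I₁ I₂ F σ p) :
    MDifferentiableAlongAt I₁ I₂ F (fun q ↦ f q • σ q) p := by
  rw [mdifferentiableAlongAt_iff] at *
  exact ⟨hσ.1, (hf.smul hσ.2).congr_of_eventuallyEq
    (coord_smul_eventuallyEq hσ.1.continuousAt f)⟩

lemma IsSmoothAlong.add (hσ : IsSmoothAlong I₁ I₂ F σ) (hτ : IsSmoothAlong I₁ I₂ F τ) :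
    IsSmoothAlong I₁ I₂ F (fun q ↦ σ q + τ q) := by
  rw [isSmoothAlong_iff] at *
  exact fun p ↦ ⟨(hσ p).1, ((hσ p).2.add (hτ p).2).congr_of_eventuallyEq
    (coord_add_eventuallyEq (hσ p).1.continuousAt)⟩

lemma IsSmoothAlong.smul {f : M₁ → ℝ} (hf : ContMDiff I₁ 𝓘(ℝ, ℝ) ∞ f)
    (hσ : IsSmoothAlong I₁ I₂ F σ) : IsSmoothAlong I₁ I₂ F (fun q ↦ f q • σ q) := by
  rw [isSmoothAlong_iff] at *
  exact fun p ↦ ⟨(hσ p).1, ((hf p).smul (hσ p).2).congr_of_eventuallyEq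
    (coord_smul_eventuallyEq (hσ p).1.continuousAt f)⟩

lemma IsSmoothAlong.sub (hσ : IsSmoothAlong I₁ I₂ F σ) (hτ : IsSmoothAlong I₁ I₂ F τ) :
    IsSmoothAlong I₁ I₂ F (fun q ↦ σ q - τ q) := by
  simpa [sub_eq_add_neg] using hσ.add (hτ.smul (f := fun _ ↦ -1) contMDiff_const)

lemma MDifferentiableAlongAt.comp (hF : MDifferentiableAt I₁ I₂ F p)
    {Y : ∀ y : M₂, TangentSpace I₂ y}
    (hY : MDifferentiableAt I₂ I₂.tangent (fun y ↦ (⟨y, Y y⟩ : TangentBundle I₂ M₂)) (F p)) :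
    MDifferentiableAlongAt I₁ I₂ F (fun q ↦ Y (F q)) p :=
  MDifferentiableAt.comp p hY hF

/-- Near a point, a differentiable vector field along `F` is a combination of restrictions of
smooth vector fields. -/
theorem mdifferentiableAlongAt_induction [T2Space M₂]
    {P : (∀ p : M₁, TangentSpace I₂ (F p)) → Prop}
    (congr : ∀ σ τ, MDifferentiableAlongAt I₁ I₂ F σ p → (∀ᶠ q in 𝓝 p, τ q = σ q) → P σ → P τ)
    (comp : ∀ Y : ∀ y : M₂, TangentSpace I₂ y, IsSmoothField I₂ Y → P (fun q ↦ Y (F q)))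
    (add : ∀ σ τ, MDifferentiableAlongAt I₁ I₂ F σ p → MDifferentiableAlongAt I₁ I₂ F τ p →
      P σ → P τ → P (fun q ↦ σ q + τ q))
    (smul : ∀ (f : M₁ → ℝ) σ, MDifferentiableAt I₁ 𝓘(ℝ, ℝ) f p →
      MDifferentiableAlongAt I₁ I₂ F σ p → P σ → P (fun q ↦ f q • σ q))
    (hσ : MDifferentiableAlongAt I₁ I₂ F σ p) : P σ := by
  obtain ⟨hF, hc⟩ := mdifferentiableAlongAt_iff.1 hσ
  set t := trivializationAt E₂ (TangentSpace I₂ : M₂ → Type _) (F p) with ht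
  let b := Module.finBasis ℝ E₂
  -- The `e i` are global fields that agree near `F p` with the coordinate frame of the chart; the
  -- `c i` below are the components of `σ` in this frame.
  choose e he hee using fun i ↦ exists_isSmoothField_eventually_eq_extend (I := I₂)
    (t.symm (F p) (b i))
  let c : Fin (Module.finrank ℝ E₂) → M₁ → ℝ := fun i q ↦ b.repr (t ⟨F q, σ q⟩).2 i
  have hcd : ∀ i, MDifferentiableAt I₁ 𝓘(ℝ, ℝ) (c i) p := fun i ↦ by
    have hL : MDifferentiableAt 𝓘(ℝ, E₂) 𝓘(ℝ, ℝ) (LinearMap.toContinuousLinearMap (b.coord i))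
        (t ⟨F p, σ p⟩).2 := (ContinuousLinearMap.differentiableAt _).mdifferentiableAt
    exact MDifferentiableAt.comp p hL hc
  have hed : ∀ i, MDifferentiableAlongAt I₁ I₂ F (fun q ↦ e i (F q)) p := fun i ↦
    .comp hF ((he i).mdifferentiableAt _)
  have key : ∀ s : Finset (Fin (Module.finrank ℝ E₂)),
      MDifferentiableAlongAt I₁ I₂ F (fun q ↦ ∑ i ∈ s, c i q • e i (F q)) p ∧
      P (fun q ↦ ∑ i ∈ s, c i q • e i (F q)) := by
    intro s
    induction s using Finset.cons_induction with
    | empty =>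
      -- The empty sum is the restriction of the zero field, so `comp` covers it.
      have h0 : IsSmoothField I₂ (fun y : M₂ ↦ (0 : TangentSpace I₂ y)) :=
        contMDiff_zeroSection ℝ (TangentSpace I₂ : M₂ → Type _)
      simpa using ⟨MDifferentiableAlongAt.comp hF (h0.mdifferentiableAt _), comp _ h0⟩
    | cons i s hi ih =>
      simp only [Finset.sum_cons]
      exact ⟨((hed i).smul (hcd i)).add ih.1,
        add _ _ ((hed i).smul (hcd i)) ih.1 (smul _ _ (hcd i) (hed i) (comp _ (he i))) ih.2⟩
  refine congr _ _ (key Finset.univ).1 ?_ (key Finset.univ).2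
  have hev : ∀ᶠ q in 𝓝 p, ∀ i, e i (F q) = extend E₂ (t.symm (F p) (b i)) (F q) :=
    Filter.eventually_all.2 fun i ↦ hF.continuousAt.eventually (hee i)
  filter_upwards [hev, eventually_mem_baseSet_of_continuousAt (I₂ := I₂) hF.continuousAt] with q h1 h2
  have h3 : ∀ i, e i (F q) = t.symmₗ ℝ (F q) (b i) := fun i ↦ by
    rw [h1 i, extend, ← ht, t.apply_mk_symm (mem_baseSet_trivializationAt _ _ _),
      Trivialization.coe_symmₗ (R := ℝ) (e := t) h2]
  simp only [h3, ← map_smul, ← map_sum, c]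
  rw [b.sum_repr, Trivialization.coe_symmₗ (R := ℝ) (e := t) h2]
  exact (t.symm_apply_apply_mk h2 _).symm

end Along

/-! ### Calculus of the pullback connection -/

section PullbackConnection

variable {E₁ H₁ M₁ : Type*} [NormedAddCommGroup E₁] [NormedSpace ℝ E₁] [FiniteDimensional ℝ E₁]
  [TopologicalSpace H₁] {I₁ : ModelWithCorners ℝ E₁ H₁}
  [TopologicalSpace M₁] [ChartedSpace H₁ M₁] [IsManifold I₁ ∞ M₁]
  [RiemannianBundle (fun x : M₁ ↦ TangentSpace I₁ x)]
  [IsContMDiffRiemannianBundle I₁ ∞ E₁ (fun x : M₁ ↦ TangentSpace I₁ x)]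
  {E₂ H₂ M₂ : Type*} [NormedAddCommGroup E₂] [NormedSpace ℝ E₂] [FiniteDimensional ℝ E₂]
  [TopologicalSpace H₂] {I₂ : ModelWithCorners ℝ E₂ H₂}
  [TopologicalSpace M₂] [ChartedSpace H₂ M₂] [IsManifold I₂ ∞ M₂]
  [RiemannianBundle (fun x : M₂ ↦ TangentSpace I₂ x)]
  [IsContMDiffRiemannianBundle I₂ ∞ E₂ (fun x : M₂ ↦ TangentSpace I₂ x)]
  {F : M₁ → M₂} {σ τ : ∀ p : M₁, TangentSpace I₂ (F p)} {p : M₁}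

lemma pullbackConnection_congr (h : ∀ᶠ q in 𝓝 p, σ q = τ q) (v : TangentSpace I₁ p) :
    pullbackConnection I₁ I₂ F σ p v = pullbackConnection I₁ I₂ F τ p v := by
  have e : (fun q ↦ (trivializationAt E₂ (TangentSpace I₂ : M₂ → Type _) (F p) ⟨F q, σ q⟩).2)
      =ᶠ[𝓝 p]
      (fun q ↦ (trivializationAt E₂ (TangentSpace I₂ : M₂ → Type _) (F p) ⟨F q, τ q⟩).2) := by
    filter_upwards [h] with q hq
    rw [hq]
  simp only [pullbackConnection, coordDerivAlong]
  rw [mvfderiv_congr_eventually e, h.self_of_nhds]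

lemma pullbackConnection_add_direction (v w : TangentSpace I₁ p) :
    pullbackConnection I₁ I₂ F σ p (v + w)
      = pullbackConnection I₁ I₂ F σ p v + pullbackConnection I₁ I₂ F σ p w := by
  simp only [pullbackConnection, coordDerivAlong, map_add, christoffel_add_left]
  rw [symm_add_of_mem (mem_baseSet_trivializationAt E₂ (TangentSpace I₂ : M₂ → Type _) (F p))]
  abel

lemma christoffel_add_right {y : M₂} (u v w : TangentSpace I₂ y) :
    christoffel u (v + w) = christoffel u v + christoffel u w := by
  rw [christoffel_symm, christoffel_add_left, christoffel_symm v, christoffel_symm w]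

lemma christoffel_smul_right {y : M₂} (c : ℝ) (u v : TangentSpace I₂ y) :
    christoffel u (c • v) = c • christoffel u v := by
  rw [christoffel_symm, christoffel_smul_left, christoffel_symm v]

lemma pullbackConnection_add (hσ : MDifferentiableAlongAt I₁ I₂ F σ p)
    (hτ : MDifferentiableAlongAt I₁ I₂ F τ p) (v : TangentSpace I₁ p) :
    pullbackConnection I₁ I₂ F (fun q ↦ σ q + τ q) p v
      = pullbackConnection I₁ I₂ F σ p v + pullbackConnection I₁ I₂ F τ p v := by
  obtain ⟨hF, hσ'⟩ := mdifferentiableAlongAt_iff.1 hσ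
  obtain ⟨-, hτ'⟩ := mdifferentiableAlongAt_iff.1 hτ
  simp only [pullbackConnection, coordDerivAlong]
  rw [mvfderiv_congr_eventually (coord_add_eventuallyEq hF.continuousAt), christoffel_add_right]
  have h2 := congrArg (fun L ↦ L v) (mvfderiv_add hσ' hτ')
  simp only [add_apply] at h2
  erw [h2]
  rw [symm_add_of_mem (mem_baseSet_trivializationAt E₂ (TangentSpace I₂ : M₂ → Type _) (F p))]
  abel

lemma pullbackConnection_smul {f : M₁ → ℝ} (hf : MDifferentiableAt I₁ 𝓘(ℝ, ℝ) f p)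
    (hσ : MDifferentiableAlongAt I₁ I₂ F σ p) (v : TangentSpace I₁ p) :
    pullbackConnection I₁ I₂ F (fun q ↦ f q • σ q) p v
      = mvfderiv I₁ f p v • σ p + f p • pullbackConnection I₁ I₂ F σ p v := by
  obtain ⟨hF, hσ'⟩ := mdifferentiableAlongAt_iff.1 hσ
  simp only [pullbackConnection, coordDerivAlong]
  rw [mvfderiv_congr_eventually (coord_smul_eventuallyEq hF.continuousAt f),
    christoffel_smul_right]
  have h2 := congrArg (fun L ↦ L v) (mvfderiv_smul hf hσ')
  simp only [add_apply, smul_apply, ContinuousLinearMap.smulRight_apply] at h2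
  have hm := mem_baseSet_trivializationAt E₂ (TangentSpace I₂ : M₂ → Type _) (F p)
  erw [h2]
  rw [symm_add_of_mem hm, symm_smul_of_mem hm, symm_smul_of_mem hm,
    Trivialization.symm_apply_apply_mk _ hm, smul_add]
  abel

lemma pullbackConnection_sub (hσ : MDifferentiableAlongAt I₁ I₂ F σ p)
    (hτ : MDifferentiableAlongAt I₁ I₂ F τ p) (v : TangentSpace I₁ p) :
    pullbackConnection I₁ I₂ F (fun q ↦ σ q - τ q) p v
      = pullbackConnection I₁ I₂ F σ p v - pullbackConnection I₁ I₂ F τ p v := by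
  have hc : MDifferentiableAt I₁ 𝓘(ℝ, ℝ) (fun _ : M₁ ↦ (-1 : ℝ)) p := mdifferentiableAt_const
  have h := pullbackConnection_add hσ (hτ.smul hc) v
  rw [pullbackConnection_smul hc hτ] at h
  simpa [sub_eq_add_neg, mvfderiv_const] using h

lemma MDifferentiableAlongAt.inner (hσ : MDifferentiableAlongAt I₁ I₂ F σ p)
    (hτ : MDifferentiableAlongAt I₁ I₂ F τ p) :
    MDifferentiableAt I₁ 𝓘(ℝ, ℝ) (fun q ↦ ⟪σ q, τ q⟫_ℝ) p :=
  MDifferentiableAt.inner_bundle (IB := I₂) (F := E₂) (E := fun x : M₂ ↦ TangentSpace I₂ x) hσ hτ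

lemma IsSmoothAlong.inner (hσ : IsSmoothAlong I₁ I₂ F σ) (hτ : IsSmoothAlong I₁ I₂ F τ) :
    ContMDiff I₁ 𝓘(ℝ, ℝ) ∞ (fun q ↦ ⟪σ q, τ q⟫_ℝ) :=
  ContMDiff.inner_bundle (IB := I₂) (F := E₂) (E := fun x : M₂ ↦ TangentSpace I₂ x) hσ hτ

lemma mvfderiv_inner_field {Y Z : ∀ y : M₂, TangentSpace I₂ y} {y : M₂}
    (hY : MDifferentiableAt I₂ I₂.tangent (fun y ↦ (⟨y, Y y⟩ : TangentBundle I₂ M₂)) y)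
    (hZ : MDifferentiableAt I₂ I₂.tangent (fun y ↦ (⟨y, Z y⟩ : TangentBundle I₂ M₂)) y)
    (v : TangentSpace I₂ y) :
    mvfderiv I₂ (fun z ↦ ⟪Y z, Z z⟫_ℝ) y v
      = ⟪leviCivita Y y v, Z y⟫_ℝ + ⟪Y y, leviCivita Z y v⟫_ℝ := by
  -- Metric compatibility is stated for a direction field; `extend E₂ v` is one whose value at `y`
  -- is `v`.
  have h := leviCivitaCov_isMetricCompatible.mvfderiv_inner_eq (extend E₂ v) hY hZ
  simp only [extend_apply_self] at h
  exact h

/-- The pullback connection is compatible with the metric. -/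
theorem mvfderiv_inner_along [T2Space M₂] (hσ : MDifferentiableAlongAt I₁ I₂ F σ p)
    (hτ : MDifferentiableAlongAt I₁ I₂ F τ p) (v : TangentSpace I₁ p) :
    mvfderiv I₁ (fun q ↦ ⟪σ q, τ q⟫_ℝ) p v
      = ⟪pullbackConnection I₁ I₂ F σ p v, τ p⟫_ℝ
        + ⟪σ p, pullbackConnection I₁ I₂ F τ p v⟫_ℝ := by
  have hF := (mdifferentiableAlongAt_iff.1 hσ).1
  -- Both sides obey the same sum and product rules in the first slot, so for a fixed second slot it
  -- suffices to test restrictions `Y ∘ F`. Applying this once to each slot leaves the case `Y ∘ F`,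
  -- `Z ∘ F`, which is the chain rule and the compatibility on `M₂`.
  have key : ∀ σ' : ∀ p : M₁, TangentSpace I₂ (F p), MDifferentiableAlongAt I₁ I₂ F σ' p →
      (∀ Y : ∀ y : M₂, TangentSpace I₂ y, IsSmoothField I₂ Y →
        mvfderiv I₁ (fun q ↦ ⟪Y (F q), σ' q⟫_ℝ) p v
        = ⟪pullbackConnection I₁ I₂ F (fun q ↦ Y (F q)) p v, σ' p⟫_ℝ
          + ⟪Y (F p), pullbackConnection I₁ I₂ F σ' p v⟫_ℝ) →
      ∀ σ, MDifferentiableAlongAt I₁ I₂ F σ p →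
      mvfderiv I₁ (fun q ↦ ⟪σ q, σ' q⟫_ℝ) p v
      = ⟪pullbackConnection I₁ I₂ F σ p v, σ' p⟫_ℝ
        + ⟪σ p, pullbackConnection I₁ I₂ F σ' p v⟫_ℝ := by
    intro σ' hσ' hY σ hσ
    refine mdifferentiableAlongAt_induction (p := p)
      (P := fun σ ↦ mvfderiv I₁ (fun q ↦ ⟪σ q, σ' q⟫_ℝ) p v
        = ⟪pullbackConnection I₁ I₂ F σ p v, σ' p⟫_ℝ
          + ⟪σ p, pullbackConnection I₁ I₂ F σ' p v⟫_ℝ) ?_ hY ?_ ?_ hσ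
    · intro σ τ hσ h ih
      have e : (fun q ↦ ⟪τ q, σ' q⟫_ℝ) =ᶠ[𝓝 p] (fun q ↦ ⟪σ q, σ' q⟫_ℝ) := by
        filter_upwards [h] with q hq
        rw [hq]
      rw [mvfderiv_congr_eventually e, pullbackConnection_congr h, h.self_of_nhds, ih]
    · intro σ τ hσ hτ h1 h2
      have e := congrArg (fun L ↦ L v) (mvfderiv_add (hσ.inner hσ') (hτ.inner hσ'))
      simp only [add_apply] at e
      simp only [inner_add_left, pullbackConnection_add hσ hτ]
      refine e.trans ?_
      rw [h1, h2]
      ring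
    · intro f σ hf hσ h1
      have e := congrArg (fun L ↦ L v) (mvfderiv_smul hf (hσ.inner hσ'))
      simp only [add_apply, smul_apply, ContinuousLinearMap.smulRight_apply] at e
      simp only [inner_add_left, real_inner_smul_left, pullbackConnection_smul hf hσ]
      refine e.trans ?_
      rw [h1]
      simp only [smul_eq_mul]
      ring
  refine key τ hτ (fun Y hY ↦ ?_) σ hσ
  have hYF : MDifferentiableAlongAt I₁ I₂ F (fun q ↦ Y (F q)) p :=
    .comp hF (hY.mdifferentiableAt _)
  have := key _ hYF (fun Z hZ ↦ ?_) τ hτ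
  · simp only [real_inner_comm] at this ⊢
    rw [this, add_comm]
  · rw [pullbackConnection_comp I₁ I₂ hF (hY.mdifferentiableAt _),
      pullbackConnection_comp I₁ I₂ hF (hZ.mdifferentiableAt _),
      ← mvfderiv_inner_field (hZ.mdifferentiableAt _) (hY.mdifferentiableAt _)]
    have h0 : MDifferentiableAt I₂ 𝓘(ℝ, ℝ) (fun y ↦ ⟪Z y, Y y⟫_ℝ) (F p) :=
      MDifferentiableAt.inner_bundle (IB := I₂) (F := E₂) (E := fun x : M₂ ↦ TangentSpace I₂ x)
        (hZ.mdifferentiableAt _) (hY.mdifferentiableAt _)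
    exact mfderiv_comp_apply p h0 hF v

/-! ### The complex structure along a map -/

variable {J : ∀ y : M₂, TangentSpace I₂ y →L[ℝ] TangentSpace I₂ y}

lemma IsAlmostHermitian.mdifferentiableAlongAt (hJ : IsAlmostHermitian I₂ J)
    (hσ : MDifferentiableAlongAt I₁ I₂ F σ p) :
    MDifferentiableAlongAt I₁ I₂ F (fun q ↦ J (F q) (σ q)) p := by
  have hF := (mdifferentiableAlongAt_iff.1 hσ).1
  have h := MDifferentiableAt.comp p ((hJ.smooth (F p)).mdifferentiableAt (by simp)) hF
  exact MDifferentiableAt.clm_bundle_apply h hσ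

lemma IsAlmostHermitian.isSmoothAlong (hJ : IsAlmostHermitian I₂ J)
    (hF : ContMDiff I₁ I₂ ∞ F) (hσ : IsSmoothAlong I₁ I₂ F σ) :
    IsSmoothAlong I₁ I₂ F (fun q ↦ J (F q) (σ q)) :=
  ContMDiff.clm_bundle_apply (hJ.smooth.comp hF) hσ

/-- On a Kähler manifold `J` is parallel for the pullback connection. -/
theorem IsKaehler.pullbackConnection_apply [T2Space M₂] (hJ : IsKaehler I₂ J)
    (hσ : MDifferentiableAlongAt I₁ I₂ F σ p) (v : TangentSpace I₁ p) :
    pullbackConnection I₁ I₂ F (fun q ↦ J (F q) (σ q)) p v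
      = J (F p) (pullbackConnection I₁ I₂ F σ p v) := by
  have hF := (mdifferentiableAlongAt_iff.1 hσ).1
  refine mdifferentiableAlongAt_induction (p := p)
    (P := fun σ ↦ pullbackConnection I₁ I₂ F (fun q ↦ J (F q) (σ q)) p v
      = J (F p) (pullbackConnection I₁ I₂ F σ p v)) ?_ ?_ ?_ ?_ hσ
  · intro σ τ _ h ih
    rw [pullbackConnection_congr h, ← ih]
    refine pullbackConnection_congr ?_ v
    filter_upwards [h] with q hq
    rw [hq]
  · intro Y hY
    have hJY : IsSmoothField I₂ (fun y ↦ J y (Y y)) := ContMDiff.clm_bundle_apply hJ.smooth hY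
    -- The Kähler condition is formulated with global vector fields, so the direction `F_* v` has to
    -- be extended to one.
    obtain ⟨X, hX, hXv⟩ := exists_isSmoothField_apply_eq (mfderiv I₁ I₂ F p v)
    rw [pullbackConnection_comp I₁ I₂ hF (hY.mdifferentiableAt _),
      pullbackConnection_comp I₁ I₂ (Y := fun y ↦ J y (Y y)) hF (hJY.mdifferentiableAt _)]
    have := hJ.parallel X Y hX hY (F p)
    rw [hXv] at this
    exact sub_eq_zero.1 this
  · intro σ τ hσ hτ h1 h2
    simp only [map_add]
    rw [pullbackConnection_add (hJ.mdifferentiableAlongAt hσ) (hJ.mdifferentiableAlongAt hτ),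
      pullbackConnection_add hσ hτ, map_add, h1, h2]
  · intro f σ hf hσ h1
    simp only [map_smul]
    rw [pullbackConnection_smul hf (hJ.mdifferentiableAlongAt hσ),
      pullbackConnection_smul hf hσ, map_add, map_smul, map_smul, h1]

end PullbackConnection

/-! ### Calculus of the Levi-Civita connection -/

section LeviCivitaRules

variable {E H M : Type*} [NormedAddCommGroup E] [NormedSpace ℝ E] [FiniteDimensional ℝ E]
  [TopologicalSpace H] {I : ModelWithCorners ℝ E H}
  [TopologicalSpace M] [ChartedSpace H M] [IsManifold I ∞ M]
  [RiemannianBundle (fun x : M ↦ TangentSpace I x)]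
  [IsContMDiffRiemannianBundle I ∞ E (fun x : M ↦ TangentSpace I x)]
  {X Y : ∀ x : M, TangentSpace I x} {x : M}

/-- Lets the rules for the pullback connection be specialized to vector fields on `M`. -/
lemma pullbackConnection_id (v : TangentSpace I x) :
    pullbackConnection I I id Y x v = leviCivita Y x v := by
  simp only [pullbackConnection, leviCivita, mfderiv_id]
  rfl

lemma leviCivita_add
    (hX : MDifferentiableAt I I.tangent (fun y ↦ (⟨y, X y⟩ : TangentBundle I M)) x)
    (hY : MDifferentiableAt I I.tangent (fun y ↦ (⟨y, Y y⟩ : TangentBundle I M)) x)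
    (v : TangentSpace I x) :
    leviCivita (fun y ↦ X y + Y y) x v = leviCivita X x v + leviCivita Y x v := by
  simp only [← pullbackConnection_id]
  exact pullbackConnection_add (F := id) hX hY v

lemma leviCivita_sub
    (hX : MDifferentiableAt I I.tangent (fun y ↦ (⟨y, X y⟩ : TangentBundle I M)) x)
    (hY : MDifferentiableAt I I.tangent (fun y ↦ (⟨y, Y y⟩ : TangentBundle I M)) x)
    (v : TangentSpace I x) :
    leviCivita (fun y ↦ X y - Y y) x v = leviCivita X x v - leviCivita Y x v := by
  simp only [← pullbackConnection_id]
  exact pullbackConnection_sub (F := id) hX hY v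

lemma leviCivita_smul {f : M → ℝ} (hf : MDifferentiableAt I 𝓘(ℝ, ℝ) f x)
    (hY : MDifferentiableAt I I.tangent (fun y ↦ (⟨y, Y y⟩ : TangentBundle I M)) x)
    (v : TangentSpace I x) :
    leviCivita (fun y ↦ f y • Y y) x v = mvfderiv I f x v • Y x + f x • leviCivita Y x v := by
  simp only [← pullbackConnection_id]
  exact pullbackConnection_smul (F := id) hf hY v

lemma leviCivita_add_direction (v w : TangentSpace I x) :
    leviCivita Y x (v + w) = leviCivita Y x v + leviCivita Y x w :=
  (leviCivitaCLM Y x).map_add v w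

lemma IsSmoothField.sub (hX : IsSmoothField I X) (hY : IsSmoothField I Y) :
    IsSmoothField I (fun y ↦ X y - Y y) :=
  ContMDiff.sub_section hX hY

end LeviCivitaRules

/-! ### Symmetry of the second fundamental form -/

section SecondFundamentalForm

variable {E₁ H₁ M₁ : Type*} [NormedAddCommGroup E₁] [NormedSpace ℝ E₁] [FiniteDimensional ℝ E₁]
  [TopologicalSpace H₁] {I₁ : ModelWithCorners ℝ E₁ H₁}
  [TopologicalSpace M₁] [ChartedSpace H₁ M₁] [IsManifold I₁ ∞ M₁]
  [RiemannianBundle (fun x : M₁ ↦ TangentSpace I₁ x)]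
  [IsContMDiffRiemannianBundle I₁ ∞ E₁ (fun x : M₁ ↦ TangentSpace I₁ x)]
  {E₂ H₂ M₂ : Type*} [NormedAddCommGroup E₂] [NormedSpace ℝ E₂] [FiniteDimensional ℝ E₂]
  [TopologicalSpace H₂] {I₂ : ModelWithCorners ℝ E₂ H₂}
  [TopologicalSpace M₂] [ChartedSpace H₂ M₂] [IsManifold I₂ ∞ M₂]
  [RiemannianBundle (fun x : M₂ ↦ TangentSpace I₂ x)]
  [IsContMDiffRiemannianBundle I₂ ∞ E₂ (fun x : M₂ ↦ TangentSpace I₂ x)]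
  {F : M₁ → M₂} {p : M₁}

lemma mdifferentiableAlongAt_pushforward (hF : ContMDiff I₁ I₂ ∞ F)
    {Y : ∀ p : M₁, TangentSpace I₁ p}
    (hY : MDifferentiableAt I₁ I₁.tangent (fun q ↦ (⟨q, Y q⟩ : TangentBundle I₁ M₁)) p) :
    MDifferentiableAlongAt I₁ I₂ F (pushforward I₁ I₂ F Y) p :=
  MDifferentiableAt.comp p ((hF.contMDiff_tangentMap (m := ∞) (by simp)).mdifferentiable (by simp) _)
    hY

lemma IsSmoothField.pushforward (hF : ContMDiff I₁ I₂ ∞ F)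
    {Y : ∀ p : M₁, TangentSpace I₁ p} (hY : IsSmoothField I₁ Y) :
    IsSmoothAlong I₁ I₂ F (pushforward I₁ I₂ F Y) :=
  (hF.contMDiff_tangentMap (m := ∞) (by simp)).comp hY

/-- In charts, `F_*` of the coordinate field with constant component `a` is `u ↦ DF(u) a`. The
equality is needed on a neighbourhood because it is differentiated once more. -/
lemma coord_mfderiv_extend_eventuallyEq [I₁.Boundaryless] (hF : ContMDiff I₁ I₂ ∞ F)
    (w : TangentSpace I₁ p) :
    (fun q ↦ (trivializationAt E₂ (TangentSpace I₂ : M₂ → Type _) (F p)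
      ⟨F q, mfderiv I₁ I₂ F q (extend E₁ w q)⟩).2) =ᶠ[𝓝 p]
    (fun u ↦ fderiv ℝ (writtenInExtChartAt I₁ I₂ p F) u (mfderiv I₁ 𝓘(ℝ, E₁) (extChartAt I₁ p) p w))
      ∘ extChartAt I₁ p := by
  filter_upwards [eventually_mem_baseSet (I := I₁) p,
    eventually_mem_baseSet_of_continuousAt (I₂ := I₂) hF.continuous.continuousAt] with q hq hFq
  have hl : (extChartAt I₁ p).symm (extChartAt I₁ p q) = q :=
    (extChartAt I₁ p).left_inv (by rwa [extChartAt_source])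
  have hu : extChartAt I₁ p q ∈ (extChartAt I₁ p).target :=
    (extChartAt I₁ p).map_source (by rwa [extChartAt_source])
  have h1 : HasMFDerivAt 𝓘(ℝ, E₁) I₁ (extChartAt I₁ p).symm (extChartAt I₁ p q)
      (mfderiv 𝓘(ℝ, E₁) I₁ (extChartAt I₁ p).symm (extChartAt I₁ p q)) := by
    have := mdifferentiableWithinAt_extChartAt_symm (I := I₁) hu
    rw [I₁.range_eq_univ, mdifferentiableWithinAt_univ] at this
    exact this.hasMFDerivAt
  have h2 : HasMFDerivAt I₁ I₂ F ((extChartAt I₁ p).symm (extChartAt I₁ p q))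
      (mfderiv I₁ I₂ F q) := by
    rw [hl]
    exact (hF.mdifferentiable (by simp) q).hasMFDerivAt
  have h3 : HasMFDerivAt I₂ 𝓘(ℝ, E₂) (extChartAt I₂ (F p))
      (F ((extChartAt I₁ p).symm (extChartAt I₁ p q)))
      (mfderiv I₂ 𝓘(ℝ, E₂) (extChartAt I₂ (F p)) (F q)) := by
    rw [hl]
    exact (mdifferentiableAt_extChartAt hFq).hasMFDerivAt
  -- Chain rule for chart ∘ `F` ∘ inverse chart; `h5` and `h6` identify the two trivializations with
  -- the derivatives of the outer charts.
  have h4 := (HasMFDerivAt.comp (extChartAt I₁ p q) (g := extChartAt I₂ (F p)) h3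
    (HasMFDerivAt.comp (extChartAt I₁ p q) h2 h1)).mfderiv
  rw [mfderiv_eq_fderiv] at h4
  have h5 : (trivializationAt E₂ (TangentSpace I₂ : M₂ → Type _) (F p)
      ⟨F q, mfderiv I₁ I₂ F q (extend E₁ w q)⟩).2
      = mfderiv I₂ 𝓘(ℝ, E₂) (extChartAt I₂ (F p)) (F q) (mfderiv I₁ I₂ F q (extend E₁ w q)) := by
    rw [← TangentBundle.continuousLinearMapAt_trivializationAt hFq]
    exact (Trivialization.continuousLinearMapAt_apply_of_mem ℝ _ hFq _).symm
  have h6 : extend E₁ w q = mfderiv 𝓘(ℝ, E₁) I₁ (extChartAt I₁ p).symm (extChartAt I₁ p q)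
      (mfderiv I₁ 𝓘(ℝ, E₁) (extChartAt I₁ p) p w) := by
    rw [← mfderivWithin_univ, ← I₁.range_eq_univ, ← TangentBundle.symmL_trivializationAt hq,
      ← TangentBundle.continuousLinearMapAt_trivializationAt (mem_chart_source H₁ p)]
    refine Eq.trans ?_ (Trivialization.symmL_apply (R := ℝ)
      (e := trivializationAt E₁ (TangentSpace I₁ : M₁ → Type _) p) (hb := hq) (y := _)).symm
    exact congrArg _ (Trivialization.continuousLinearMapAt_apply_of_mem ℝ _
      (mem_baseSet_trivializationAt E₁ (TangentSpace I₁ : M₁ → Type _) p) w).symm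
  rw [h5, h6]
  exact (congrArg (fun L : E₁ →L[ℝ] E₂ ↦ L (mfderiv I₁ 𝓘(ℝ, E₁) (extChartAt I₁ p) p w)) h4).symm

/-- Differentiating `u ↦ DF(u) a` produces the second derivative of `F` in charts, whose symmetry in
`v` and `w` is Schwarz's theorem. -/
lemma coordDerivAlong_pushforward_extend [I₁.Boundaryless] (hF : ContMDiff I₁ I₂ ∞ F)
    (v w : TangentSpace I₁ p) :
    coordDerivAlong I₁ I₂ F (pushforward I₁ I₂ F (extend E₁ w)) p v =
      (trivializationAt E₂ (TangentSpace I₂ : M₂ → Type _) (F p)).symm (F p)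
        (fderiv ℝ (fderiv ℝ (writtenInExtChartAt I₁ I₂ p F)) (extChartAt I₁ p p)
          (mfderiv I₁ 𝓘(ℝ, E₁) (extChartAt I₁ p) p v)
          (mfderiv I₁ 𝓘(ℝ, E₁) (extChartAt I₁ p) p w)) := by
  have h : ContDiffAt ℝ ∞ (writtenInExtChartAt I₁ I₂ p F) (extChartAt I₁ p p) := by
    have := (contMDiffAt_iff.1 (hF p)).2
    rwa [I₁.range_eq_univ, contDiffWithinAt_univ] at this
  have hd : DifferentiableAt ℝ (fderiv ℝ (writtenInExtChartAt I₁ I₂ p F)) (extChartAt I₁ p p) :=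
    (h.fderiv_right (m := ∞) (by simp)).differentiableAt (by simp)
  have hφ : MDifferentiableAt I₁ 𝓘(ℝ, E₁) (extChartAt I₁ p) p :=
    mdifferentiableAt_extChartAt (mem_chart_source H₁ p)
  simp only [coordDerivAlong, pushforward]
  rw [mvfderiv_congr_eventually (coord_mfderiv_extend_eventuallyEq hF w)]
  have key : ∀ a : E₁, mfderiv I₁ 𝓘(ℝ, E₂)
      ((fun u ↦ fderiv ℝ (writtenInExtChartAt I₁ I₂ p F) u a) ∘ extChartAt I₁ p) p v
      = fderiv ℝ (fderiv ℝ (writtenInExtChartAt I₁ I₂ p F)) (extChartAt I₁ p p)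
          (mfderiv I₁ 𝓘(ℝ, E₁) (extChartAt I₁ p) p v) a := by
    intro a
    refine (mfderiv_comp_apply p
      (hd.clm_apply (differentiableAt_const a)).mdifferentiableAt hφ v).trans ?_
    have h1 : ∀ b : E₁, fderiv ℝ (fun u ↦ fderiv ℝ (writtenInExtChartAt I₁ I₂ p F) u a)
        (extChartAt I₁ p p) b
        = fderiv ℝ (fderiv ℝ (writtenInExtChartAt I₁ I₂ p F)) (extChartAt I₁ p p) b a := by
      intro b
      rw [fderiv_clm_apply hd (differentiableAt_const a)]
      simp [-writtenInExtChartAt, -extChartAt]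
    rw [mfderiv_eq_fderiv]
    exact h1 _
  exact congrArg (fun z : E₂ ↦
    (trivializationAt E₂ (TangentSpace I₂ : M₂ → Type _) (F p)).symm (F p) z) (key _)

/-- The second fundamental form is symmetric on coordinate vector fields. -/
lemma pullbackConnection_pushforward_extend_symm [I₁.Boundaryless] (hF : ContMDiff I₁ I₂ ∞ F)
    (v w : TangentSpace I₁ p) :
    pullbackConnection I₁ I₂ F (pushforward I₁ I₂ F (extend E₁ w)) p v
      = pullbackConnection I₁ I₂ F (pushforward I₁ I₂ F (extend E₁ v)) p w := by
  have hs : IsSymmSndFDerivAt ℝ (writtenInExtChartAt I₁ I₂ p F) (extChartAt I₁ p p) := by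
    have h : ContDiffAt ℝ ∞ (writtenInExtChartAt I₁ I₂ p F) (extChartAt I₁ p p) := by
      have := (contMDiffAt_iff.1 (hF p)).2
      rwa [I₁.range_eq_univ, contDiffWithinAt_univ] at this
    exact h.isSymmSndFDerivAt (by
      rw [minSmoothness_of_isRCLikeNormedField]
      exact ENat.LEInfty.out)
  simp only [pullbackConnection, coordDerivAlong_pushforward_extend hF, pushforward,
    extend_apply_self]
  rw [christoffel_symm]
  exact congrArg (fun z : E₂ ↦ (trivializationAt E₂ (TangentSpace I₂ : M₂ → Type _) (F p)).symm (F p) z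
    + christoffel (mfderiv I₁ I₂ F p w) (mfderiv I₁ I₂ F p v)) (hs _ _)

/-- For `f • Y` both terms produce the derivative of `f` times `F_* Y`, and these cancel. Hence `Y`
may be replaced by the coordinate field with the same value at `p`, for which the symmetry is known.
-/
lemma tensorialAt_secondFundamentalForm (hF : ContMDiff I₁ I₂ ∞ F) (v : TangentSpace I₁ p) :
    TensorialAt I₁ E₁ (fun Y : ∀ p : M₁, TangentSpace I₁ p ↦
      pullbackConnection I₁ I₂ F (pushforward I₁ I₂ F Y) p v
        - mfderiv I₁ I₂ F p (leviCivita Y p v)) p where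
  smul := by
    intro f Y hf hY
    have h1 : pushforward I₁ I₂ F (f • Y) = fun q ↦ f q • pushforward I₁ I₂ F Y q := by
      ext q
      simp [pushforward]
    rw [h1, pullbackConnection_smul hf (mdifferentiableAlongAt_pushforward hF hY)]
    have h2 := leviCivita_smul hf hY v
    erw [h2]
    rw [map_add, map_smul, map_smul, pushforward]
    module
  add := by
    intro X Y hX hY
    have h1 : pushforward I₁ I₂ F (X + Y)
        = fun q ↦ pushforward I₁ I₂ F X q + pushforward I₁ I₂ F Y q := by
      ext q
      simp [pushforward]
    rw [h1, pullbackConnection_add (mdifferentiableAlongAt_pushforward hF hX)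
      (mdifferentiableAlongAt_pushforward hF hY)]
    have h2 := leviCivita_add hX hY v
    erw [h2]
    rw [map_add]
    module

/-- The second fundamental form of a map is symmetric. -/
theorem secondFundamentalForm_symm [I₁.Boundaryless] (hF : ContMDiff I₁ I₂ ∞ F)
    {X Y : ∀ p : M₁, TangentSpace I₁ p} (hX : IsSmoothField I₁ X) (hY : IsSmoothField I₁ Y)
    (p : M₁) :
    secondFundamentalForm I₁ I₂ F X Y p = secondFundamentalForm I₁ I₂ F Y X p := by
  have h : ∀ {Y : ∀ p : M₁, TangentSpace I₁ p}, IsSmoothField I₁ Y → ∀ v,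
      pullbackConnection I₁ I₂ F (pushforward I₁ I₂ F Y) p v
        - mfderiv I₁ I₂ F p (leviCivita Y p v)
      = pullbackConnection I₁ I₂ F (pushforward I₁ I₂ F (extend E₁ (Y p))) p v
        - mfderiv I₁ I₂ F p (christoffel v (Y p)) := by
    intro Y hY v
    rw [← leviCivita_extend]
    exact (tensorialAt_secondFundamentalForm hF v).pointwise (hY.mdifferentiableAt p)
      (mdifferentiableAt_extend ..) (extend_apply_self ..).symm
  simp only [secondFundamentalForm]
  rw [h hY, h hX, pullbackConnection_pushforward_extend_symm hF, christoffel_symm]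

end SecondFundamentalForm

/-! ### Smoothness tested by inner products -/

section InnerCriterion

variable {E H M : Type*} [NormedAddCommGroup E] [NormedSpace ℝ E] [FiniteDimensional ℝ E]
  [TopologicalSpace H] {I : ModelWithCorners ℝ E H}
  [TopologicalSpace M] [ChartedSpace H M] [IsManifold I ∞ M]
  [RiemannianBundle (fun x : M ↦ TangentSpace I x)]
  [IsContMDiffRiemannianBundle I ∞ E (fun x : M ↦ TangentSpace I x)]

/-- A vector field is smooth as soon as its inner products with all smooth vector fields are. -/
theorem isSmoothField_of_inner [T2Space M] {Z : ∀ x : M, TangentSpace I x}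
    (h : ∀ W : ∀ x : M, TangentSpace I x, IsSmoothField I W →
      ContMDiff I 𝓘(ℝ, ℝ) ∞ (fun x ↦ ⟪Z x, W x⟫_ℝ)) : IsSmoothField I Z := by
  intro x
  refine (contMDiffAt_section x).2 ?_
  set t := trivializationAt E (TangentSpace I : M → Type _) x with ht
  have hx : x ∈ t.baseSet := mem_baseSet_trivializationAt E (TangentSpace I : M → Type _) x
  let b := Module.finBasis ℝ E
  choose e he hee using fun i ↦ exists_isSmoothField_eventually_eq_extend (I := I)
    (t.symm x (b i))
  let C : Fin (Module.finrank ℝ E) → Fin (Module.finrank ℝ E) →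
      E →L[ℝ] (Fin (Module.finrank ℝ E) → ℝ) := fun i j ↦
    (LinearMap.toContinuousLinearMap (b.coord j)).smulRight (Pi.single i 1)
  -- `T q` is the Gram matrix of the frame `e`, read as a map from components to inner products with
  -- the frame. The components of `Z` solve `T q a = r q`, so they are smooth because `T` and `r`
  -- are and matrix inversion is.
  let T : M → E →L[ℝ] (Fin (Module.finrank ℝ E) → ℝ) := fun q ↦
    ∑ i, ∑ j, ⟪e j q, e i q⟫_ℝ • C i j
  let r : M → (Fin (Module.finrank ℝ E) → ℝ) := fun q i ↦ ⟪Z q, e i q⟫_ℝ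
  have hTs : ContMDiffAt I 𝓘(ℝ, E →L[ℝ] (Fin (Module.finrank ℝ E) → ℝ)) ∞ T x := by
    refine ContMDiffAt.sum fun i _ ↦ ContMDiffAt.sum fun j _ ↦ ?_
    have hij : ContMDiffAt I 𝓘(ℝ, ℝ) ∞ (fun q ↦ ⟪e j q, e i q⟫_ℝ) x :=
      IsSmoothAlong.inner (F := id) (he j) (he i) x
    exact hij.smul contMDiffAt_const
  have hrs : ContMDiffAt I 𝓘(ℝ, Fin (Module.finrank ℝ E) → ℝ) ∞ r x :=
    contMDiffAt_pi_space.2 fun i ↦ h _ (he i) x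
  have hev : ∀ᶠ q in 𝓝 x, q ∈ t.baseSet ∧ ∀ i, e i q = t.symmₗ ℝ q (b i) := by
    filter_upwards [Filter.eventually_all.2 hee, eventually_mem_baseSet (I := I) x] with q h1 h2
    refine ⟨h2, fun i ↦ ?_⟩
    rw [h1 i, extend, ← ht, t.apply_mk_symm hx, Trivialization.coe_symmₗ (R := ℝ) (e := t) h2]
  have hTa : ∀ q, (∀ i, e i q = t.symmₗ ℝ q (b i)) → ∀ a i,
      T q a i = ⟪t.symmₗ ℝ q a, e i q⟫_ℝ := by
    intro q hq a i
    conv_rhs => rw [← b.sum_repr a, map_sum, sum_inner]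
    simp only [T, C, sum_apply, smul_apply, ContinuousLinearMap.smulRight_apply,
      Finset.sum_apply, Pi.smul_apply, Pi.single_apply, map_smul, real_inner_smul_left, hq,
      smul_eq_mul]
    rw [Finset.sum_eq_single i (fun k _ hk ↦ by simp [hk.symm]) (by simp)]
    refine Finset.sum_congr rfl fun j _ ↦ ?_
    simp [mul_comm]
  have hTZ : ∀ᶠ q in 𝓝 x, T q (t ⟨q, Z q⟩).2 = r q := by
    filter_upwards [hev] with q hq
    ext i
    rw [hTa q hq.2, Trivialization.coe_symmₗ (R := ℝ) (e := t) hq.1,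
      t.symm_apply_apply_mk hq.1]
  -- Injectivity of the Gram matrix is positive definiteness: a vector orthogonal to the whole frame
  -- is orthogonal to itself.
  have hinj : Function.Injective (T x : E →ₗ[ℝ] (Fin (Module.finrank ℝ E) → ℝ)) := by
    refine (injective_iff_map_eq_zero _).2 fun a ha ↦ ?_
    obtain ⟨-, hex⟩ := hev.self_of_nhds
    have h0 : ∀ i, ⟪t.symmₗ ℝ x a, t.symmₗ ℝ x (b i)⟫_ℝ = 0 := fun i ↦ by
      rw [← hex i, ← hTa x hex a i]
      exact congrFun ha i
    have h1 : ∀ c, ⟪t.symmₗ ℝ x a, t.symmₗ ℝ x c⟫_ℝ = 0 := fun c ↦ by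
      rw [← b.sum_repr c, map_sum, inner_sum]
      refine Finset.sum_eq_zero fun i _ ↦ ?_
      rw [map_smul, real_inner_smul_right, h0, mul_zero]
    have h2 := inner_self_eq_zero.1 (h1 a)
    rw [Trivialization.coe_symmₗ (R := ℝ) (e := t) hx] at h2
    have h3 := congrArg Prod.snd (t.apply_mk_symm hx a)
    rw [h2] at h3
    exact h3.symm.trans (t.linear ℝ hx).map_zero
  let L : E ≃L[ℝ] (Fin (Module.finrank ℝ E) → ℝ) :=
    (LinearMap.linearEquivOfInjective _ hinj (by simp)).toContinuousLinearEquiv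
  have hL : (L : E →L[ℝ] (Fin (Module.finrank ℝ E) → ℝ)) = T x := by
    ext a : 1
    rfl
  have hinv : ContMDiffAt I 𝓘(ℝ, (Fin (Module.finrank ℝ E) → ℝ) →L[ℝ] E) ∞
      (fun q ↦ (T q).inverse) x := by
    have := contDiffAt_map_inverse (n := ∞) L
    rw [hL] at this
    exact this.contMDiffAt.comp x hTs
  refine (hinv.clm_apply hrs).congr_of_eventuallyEq ?_
  -- `inverse` is a true inverse only where `T q` is invertible; invertibility is an open condition
  -- and holds at `x`.
  have hopen : ∀ᶠ q in 𝓝 x, T q ∈ Set.range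
      ((↑) : (E ≃L[ℝ] (Fin (Module.finrank ℝ E) → ℝ)) → _) := by
    refine hTs.continuousAt.eventually ?_
    rw [← hL]
    exact L.nhds
  filter_upwards [hTZ, hopen] with q h1 ⟨L', h2⟩
  rw [← h1, ← h2, ContinuousLinearMap.inverse_equiv]
  exact (L'.symm_apply_apply _).symm

end InnerCriterion

/-! ### Horizontal, tangential and normal projections -/

section Projections

variable {E₁ H₁ M₁ : Type*} [NormedAddCommGroup E₁] [NormedSpace ℝ E₁] [FiniteDimensional ℝ E₁]
  [TopologicalSpace H₁] {I₁ : ModelWithCorners ℝ E₁ H₁}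
  [TopologicalSpace M₁] [ChartedSpace H₁ M₁] [IsManifold I₁ ∞ M₁]
  [RiemannianBundle (fun x : M₁ ↦ TangentSpace I₁ x)]
  [IsContMDiffRiemannianBundle I₁ ∞ E₁ (fun x : M₁ ↦ TangentSpace I₁ x)]
  {E₂ H₂ M₂ : Type*} [NormedAddCommGroup E₂] [NormedSpace ℝ E₂] [FiniteDimensional ℝ E₂]
  [TopologicalSpace H₂] {I₂ : ModelWithCorners ℝ E₂ H₂}
  [TopologicalSpace M₂] [ChartedSpace H₂ M₂] [IsManifold I₂ ∞ M₂]
  [RiemannianBundle (fun x : M₂ ↦ TangentSpace I₂ x)]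
  [IsContMDiffRiemannianBundle I₂ ∞ E₂ (fun x : M₂ ↦ TangentSpace I₂ x)]
  {F : M₁ → M₂} {p : M₁}

variable (I₁ I₂) in
/-- The component of `v` in `(ker F_{*p})^⊥`. -/
def horizontalPart (F : M₁ → M₂) (p : M₁) (v : TangentSpace I₁ p) : TangentSpace I₁ p :=
  (horizontal I₁ I₂ F p).starProjection v

lemma horizontalPart_mem (v : TangentSpace I₁ p) :
    horizontalPart I₁ I₂ F p v ∈ horizontal I₁ I₂ F p :=
  Submodule.starProjection_apply_mem _ _

lemma horizontalPart_eq_self {v : TangentSpace I₁ p} (hv : v ∈ horizontal I₁ I₂ F p) :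
    horizontalPart I₁ I₂ F p v = v :=
  Submodule.starProjection_eq_self_iff.2 hv

lemma sub_horizontalPart_mem (v : TangentSpace I₁ p) :
    v - horizontalPart I₁ I₂ F p v ∈ vertical I₁ I₂ F p := by
  have h := Submodule.sub_starProjection_mem_orthogonal (K := horizontal I₁ I₂ F p) v
  rwa [horizontal, Submodule.orthogonal_orthogonal] at h

lemma mfderiv_eq_zero_of_mem_vertical {v : TangentSpace I₁ p} (hv : v ∈ vertical I₁ I₂ F p) :
    mfderiv I₁ I₂ F p v = 0 := hv

lemma mfderiv_horizontalPart (v : TangentSpace I₁ p) :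
    mfderiv I₁ I₂ F p (horizontalPart I₁ I₂ F p v) = mfderiv I₁ I₂ F p v := by
  have h := mfderiv_eq_zero_of_mem_vertical (sub_horizontalPart_mem (I₂ := I₂) (F := F) v)
  rw [map_sub, sub_eq_zero] at h
  exact h.symm

lemma inner_horizontal_vertical {v w : TangentSpace I₁ p} (hv : v ∈ horizontal I₁ I₂ F p)
    (hw : w ∈ vertical I₁ I₂ F p) : ⟪v, w⟫_ℝ = 0 :=
  Submodule.inner_left_of_mem_orthogonal hw hv

lemma inner_horizontalPart_left (v w : TangentSpace I₁ p) :
    ⟪horizontalPart I₁ I₂ F p v, w⟫_ℝ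
      = ⟪horizontalPart I₁ I₂ F p v, horizontalPart I₁ I₂ F p w⟫_ℝ := by
  have h := inner_horizontal_vertical (horizontalPart_mem (F := F) (I₂ := I₂) v)
    (sub_horizontalPart_mem (F := F) (I₂ := I₂) w)
  rw [inner_sub_right, sub_eq_zero] at h
  exact h

/-- This says that `F_*ᵀ F_*` is the horizontal projection. It expresses that projection through
`F_*`, which is known to be smooth. -/
lemma IsRiemannianMap.inner_mfderiv (hF : IsRiemannianMap I₁ I₂ F) (v w : TangentSpace I₁ p) :
    ⟪mfderiv I₁ I₂ F p v, mfderiv I₁ I₂ F p w⟫_ℝ = ⟪horizontalPart I₁ I₂ F p v, w⟫_ℝ := by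
  rw [← mfderiv_horizontalPart v, ← mfderiv_horizontalPart w,
    hF.isometric p _ (horizontalPart_mem v) _ (horizontalPart_mem w), inner_horizontalPart_left v w]

lemma IsRiemannianMap.inner_mfderiv_of_mem (hF : IsRiemannianMap I₁ I₂ F)
    {v : TangentSpace I₁ p} (hv : v ∈ horizontal I₁ I₂ F p) (w : TangentSpace I₁ p) :
    ⟪mfderiv I₁ I₂ F p v, mfderiv I₁ I₂ F p w⟫_ℝ = ⟪v, w⟫_ℝ := by
  rw [hF.inner_mfderiv, horizontalPart_eq_self hv]

lemma IsRiemannianMap.isSmoothField_horizontalPart [T2Space M₁] (hF : IsRiemannianMap I₁ I₂ F)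
    {Y : ∀ p : M₁, TangentSpace I₁ p} (hY : IsSmoothField I₁ Y) :
    IsSmoothField I₁ (fun p ↦ horizontalPart I₁ I₂ F p (Y p)) := by
  refine isSmoothField_of_inner fun W hW ↦ ?_
  simp only [← hF.inner_mfderiv]
  exact (hY.pushforward hF.smooth).inner (hW.pushforward hF.smooth)

lemma tangentialPart_mem (u : TangentSpace I₂ (F p)) :
    tangentialPart I₁ I₂ F p u ∈ rangeSpace I₁ I₂ F p :=
  Submodule.starProjection_apply_mem _ _

lemma normalPart_mem (u : TangentSpace I₂ (F p)) :
    normalPart I₁ I₂ F p u ∈ normalSpace I₁ I₂ F p :=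
  Submodule.starProjection_apply_mem _ _

lemma tangentialPart_add_normalPart (u : TangentSpace I₂ (F p)) :
    tangentialPart I₁ I₂ F p u + normalPart I₁ I₂ F p u = u :=
  Submodule.starProjection_add_starProjection_orthogonal _

lemma normalPart_eq_self {u : TangentSpace I₂ (F p)} (hu : u ∈ normalSpace I₁ I₂ F p) :
    normalPart I₁ I₂ F p u = u :=
  Submodule.starProjection_eq_self_iff.2 hu

lemma inner_range_normal {u v : TangentSpace I₂ (F p)} (hu : u ∈ rangeSpace I₁ I₂ F p)
    (hv : v ∈ normalSpace I₁ I₂ F p) : ⟪u, v⟫_ℝ = 0 :=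
  Submodule.inner_right_of_mem_orthogonal hu hv

lemma inner_tangentialPart_of_mem (u : TangentSpace I₂ (F p)) {v : TangentSpace I₂ (F p)}
    (hv : v ∈ rangeSpace I₁ I₂ F p) : ⟪tangentialPart I₁ I₂ F p u, v⟫_ℝ = ⟪u, v⟫_ℝ := by
  conv_rhs => rw [← tangentialPart_add_normalPart (I₁ := I₁) u]
  rw [inner_add_left, real_inner_comm v (normalPart I₁ I₂ F p u),
    inner_range_normal hv (normalPart_mem u), add_zero]

lemma inner_normalPart_of_mem (u : TangentSpace I₂ (F p)) {v : TangentSpace I₂ (F p)}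
    (hv : v ∈ normalSpace I₁ I₂ F p) : ⟪normalPart I₁ I₂ F p u, v⟫_ℝ = ⟪u, v⟫_ℝ := by
  conv_rhs => rw [← tangentialPart_add_normalPart (I₁ := I₁) u]
  rw [inner_add_left, inner_range_normal (tangentialPart_mem u) hv, zero_add]

lemma mfderiv_mem_rangeSpace (v : TangentSpace I₁ p) :
    mfderiv I₁ I₂ F p v ∈ rangeSpace I₁ I₂ F p := ⟨v, rfl⟩

lemma exists_horizontal_of_mem_rangeSpace {u : TangentSpace I₂ (F p)}
    (hu : u ∈ rangeSpace I₁ I₂ F p) :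
    ∃ v ∈ horizontal I₁ I₂ F p, mfderiv I₁ I₂ F p v = u := by
  obtain ⟨v, rfl⟩ := hu
  exact ⟨_, horizontalPart_mem v, mfderiv_horizontalPart v⟩

/-- The tangential part of a smooth vector field along `F` is the image of a smooth horizontal
vector field. -/
theorem IsRiemannianMap.exists_pushforward_eq_tangentialPart [T2Space M₁]
    (hF : IsRiemannianMap I₁ I₂ F) {σ : ∀ p : M₁, TangentSpace I₂ (F p)}
    (hσ : IsSmoothAlong I₁ I₂ F σ) :
    ∃ Z : ∀ p : M₁, TangentSpace I₁ p, IsSmoothField I₁ Z ∧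
      (∀ p, Z p ∈ horizontal I₁ I₂ F p) ∧
      pushforward I₁ I₂ F Z = fun p ↦ tangentialPart I₁ I₂ F p (σ p) := by
  choose Z hZ hZσ using fun p ↦
    exists_horizontal_of_mem_rangeSpace (tangentialPart_mem (I₁ := I₁) (σ p))
  refine ⟨Z, isSmoothField_of_inner fun W hW ↦ ?_, hZ, funext hZσ⟩
  -- `Z` is the adjoint of `F_*` applied to `σ`, so its inner products are smooth although `Z` was
  -- chosen pointwise.
  have h : ∀ p, ⟪Z p, W p⟫_ℝ = ⟪σ p, pushforward I₁ I₂ F W p⟫_ℝ := fun p ↦ by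
    rw [← hF.inner_mfderiv_of_mem (hZ p), hZσ,
      inner_tangentialPart_of_mem _ (mfderiv_mem_rangeSpace _), pushforward]
  simp only [h]
  exact hσ.inner (hW.pushforward hF.smooth)

lemma IsRiemannianMap.isSmoothAlong_tangentialPart [T2Space M₁] (hF : IsRiemannianMap I₁ I₂ F)
    {σ : ∀ p : M₁, TangentSpace I₂ (F p)} (hσ : IsSmoothAlong I₁ I₂ F σ) :
    IsSmoothAlong I₁ I₂ F (fun p ↦ tangentialPart I₁ I₂ F p (σ p)) := by
  obtain ⟨Z, hZ, -, h⟩ := hF.exists_pushforward_eq_tangentialPart hσ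
  exact h ▸ hZ.pushforward hF.smooth

lemma IsRiemannianMap.isSmoothAlong_normalPart [T2Space M₁] (hF : IsRiemannianMap I₁ I₂ F)
    {σ : ∀ p : M₁, TangentSpace I₂ (F p)} (hσ : IsSmoothAlong I₁ I₂ F σ) :
    IsSmoothAlong I₁ I₂ F (fun p ↦ normalPart I₁ I₂ F p (σ p)) := by
  have h : ∀ p, normalPart I₁ I₂ F p (σ p) = σ p - tangentialPart I₁ I₂ F p (σ p) := fun p ↦
    eq_sub_of_add_eq' (tangentialPart_add_normalPart (σ p))
  simp only [h]
  exact hσ.sub (hF.isSmoothAlong_tangentialPart hσ)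

end Projections

/-! ### The second fundamental form of a Riemannian map -/

section Slant

variable {E₁ H₁ M₁ : Type*} [NormedAddCommGroup E₁] [NormedSpace ℝ E₁] [FiniteDimensional ℝ E₁]
  [TopologicalSpace H₁] {I₁ : ModelWithCorners ℝ E₁ H₁}
  [TopologicalSpace M₁] [ChartedSpace H₁ M₁] [IsManifold I₁ ∞ M₁]
  [RiemannianBundle (fun x : M₁ ↦ TangentSpace I₁ x)]
  [IsContMDiffRiemannianBundle I₁ ∞ E₁ (fun x : M₁ ↦ TangentSpace I₁ x)]
  {E₂ H₂ M₂ : Type*} [NormedAddCommGroup E₂] [NormedSpace ℝ E₂] [FiniteDimensional ℝ E₂]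
  [TopologicalSpace H₂] {I₂ : ModelWithCorners ℝ E₂ H₂}
  [TopologicalSpace M₂] [ChartedSpace H₂ M₂] [IsManifold I₂ ∞ M₂]
  [RiemannianBundle (fun x : M₂ ↦ TangentSpace I₂ x)]
  [IsContMDiffRiemannianBundle I₂ ∞ E₂ (fun x : M₂ ↦ TangentSpace I₂ x)]
  {F : M₁ → M₂} {p : M₁}

lemma pullbackConnection_zero (hF : MDifferentiableAt I₁ I₂ F p) (v : TangentSpace I₁ p) :
    pullbackConnection I₁ I₂ F (fun _ ↦ 0) p v = 0 := by
  have h0 : IsSmoothField I₂ (fun y : M₂ ↦ (0 : TangentSpace I₂ y)) :=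
    contMDiff_zeroSection ℝ (TangentSpace I₂ : M₂ → Type _)
  have h := MDifferentiableAlongAt.comp hF (h0.mdifferentiableAt (F p))
  simpa using pullbackConnection_sub h h v

/-- Only the value at `p` of the direction field enters, so a decomposition at that point is enough.
-/
lemma secondFundamentalForm_eq_add_left {X X₁ X₂ Y : ∀ p : M₁, TangentSpace I₁ p}
    (h : X p = X₁ p + X₂ p) :
    secondFundamentalForm I₁ I₂ F X Y p
      = secondFundamentalForm I₁ I₂ F X₁ Y p + secondFundamentalForm I₁ I₂ F X₂ Y p := by
  simp only [secondFundamentalForm, h, pullbackConnection_add_direction, leviCivita_add_direction,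
    map_add]
  abel

lemma secondFundamentalForm_eq_add_right (hF : ContMDiff I₁ I₂ ∞ F)
    {X Y Y₁ Y₂ : ∀ p : M₁, TangentSpace I₁ p} (h₁ : IsSmoothField I₁ Y₁)
    (h₂ : IsSmoothField I₁ Y₂) (h : ∀ q, Y q = Y₁ q + Y₂ q) :
    secondFundamentalForm I₁ I₂ F X Y p
      = secondFundamentalForm I₁ I₂ F X Y₁ p + secondFundamentalForm I₁ I₂ F X Y₂ p := by
  obtain rfl : Y = fun q ↦ Y₁ q + Y₂ q := funext h
  have hp : pushforward I₁ I₂ F (fun q ↦ Y₁ q + Y₂ q)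
      = fun q ↦ pushforward I₁ I₂ F Y₁ q + pushforward I₁ I₂ F Y₂ q := by
    ext q
    simp [pushforward]
  simp only [secondFundamentalForm]
  rw [hp, pullbackConnection_add ((h₁.pushforward hF).mdifferentiableAlongAt p)
      ((h₂.pushforward hF).mdifferentiableAlongAt p),
    leviCivita_add (h₁.mdifferentiableAt p) (h₂.mdifferentiableAt p), map_add]
  abel

/-- Since `F_* U` is the zero section, only the Levi-Civita term survives; `∇_X U` is vertical
exactly when the form vanishes. -/
lemma secondFundamentalForm_of_vertical (hF : ContMDiff I₁ I₂ ∞ F)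
    {X U : ∀ p : M₁, TangentSpace I₁ p} (hU : ∀ q, U q ∈ vertical I₁ I₂ F q) :
    secondFundamentalForm I₁ I₂ F X U p = -mfderiv I₁ I₂ F p (leviCivita U p (X p)) := by
  have h : pushforward I₁ I₂ F U = fun _ ↦ 0 := funext fun q ↦ hU q
  rw [secondFundamentalForm, h, pullbackConnection_zero (hF.mdifferentiable (by simp) p), zero_sub]

lemma inner_secondFundamentalForm_of_normal {X Y : ∀ p : M₁, TangentSpace I₁ p}
    {V : TangentSpace I₂ (F p)} (hV : V ∈ normalSpace I₁ I₂ F p) :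
    ⟪secondFundamentalForm I₁ I₂ F X Y p, V⟫_ℝ
      = ⟪pullbackConnection I₁ I₂ F (pushforward I₁ I₂ F Y) p (X p), V⟫_ℝ := by
  rw [secondFundamentalForm, inner_sub_left, inner_range_normal (mfderiv_mem_rangeSpace _) hV,
    sub_zero]

namespace IsRiemannianMap

/-- Differentiate `g₂(F_* Y, F_* Z) = g(Y, Z)` along `X` with the two metric connections. The terms
`g(∇_X Y, Z)` and `g(Y, ∇_X Z)` are also `g₂(F_* ∇_X Y, F_* Z)` and `g₂(F_* Y, F_* ∇_X Z)`, because
`Z` and `Y` are horizontal. -/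
lemma inner_secondFundamentalForm_skew [T2Space M₂] (hF : IsRiemannianMap I₁ I₂ F)
    {X Y Z : ∀ p : M₁, TangentSpace I₁ p} (hY : IsSmoothField I₁ Y) (hZ : IsSmoothField I₁ Z)
    (hYh : ∀ q, Y q ∈ horizontal I₁ I₂ F q) (hZh : ∀ q, Z q ∈ horizontal I₁ I₂ F q) (p : M₁) :
    ⟪secondFundamentalForm I₁ I₂ F X Y p, pushforward I₁ I₂ F Z p⟫_ℝ
      = -⟪secondFundamentalForm I₁ I₂ F X Z p, pushforward I₁ I₂ F Y p⟫_ℝ := by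
  have h1 := mvfderiv_inner_along ((hY.pushforward hF.smooth).mdifferentiableAlongAt p)
    ((hZ.pushforward hF.smooth).mdifferentiableAlongAt p) (X p)
  have h2 := mvfderiv_inner_field (hY.mdifferentiableAt p) (hZ.mdifferentiableAt p) (X p)
  have h3 : (fun q ↦ ⟪pushforward I₁ I₂ F Y q, pushforward I₁ I₂ F Z q⟫_ℝ)
      = fun q ↦ ⟪Y q, Z q⟫_ℝ := funext fun q ↦ hF.inner_mfderiv_of_mem (hYh q) _
  rw [h3, h2] at h1
  simp only [secondFundamentalForm, inner_sub_left]
  have h4 := hF.inner_mfderiv_of_mem (hYh p) (leviCivita Z p (X p))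
  have h5 := hF.inner_mfderiv_of_mem (hZh p) (leviCivita Y p (X p))
  rw [real_inner_comm _ (Z p)] at h5
  simp only [pushforward] at h1 ⊢
  rw [real_inner_comm _ (mfderiv I₁ I₂ F p (leviCivita Y p (X p))), h5,
    real_inner_comm _ (mfderiv I₁ I₂ F p (leviCivita Z p (X p))), h4]
  rw [real_inner_comm _ (mfderiv I₁ I₂ F p (Y p))] at h1
  linarith

/-- On horizontal fields the second fundamental form of a Riemannian map is normal. -/
theorem inner_secondFundamentalForm_pushforward [T2Space M₂] [I₁.Boundaryless]
    (hF : IsRiemannianMap I₁ I₂ F)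
    {X Y Z : ∀ p : M₁, TangentSpace I₁ p} (hX : IsSmoothField I₁ X) (hY : IsSmoothField I₁ Y)
    (hZ : IsSmoothField I₁ Z) (hXh : ∀ q, X q ∈ horizontal I₁ I₂ F q)
    (hYh : ∀ q, Y q ∈ horizontal I₁ I₂ F q) (hZh : ∀ q, Z q ∈ horizontal I₁ I₂ F q) (p : M₁) :
    ⟪secondFundamentalForm I₁ I₂ F X Y p, pushforward I₁ I₂ F Z p⟫_ℝ = 0 := by
  -- A trilinear expression that is symmetric in the first two slots and skew in the last two is
  -- zero: the three cyclic skew relations, rewritten by symmetry, give `a = -b`, `b = -c`, `c =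
  -- -a`.
  have h1 := hF.inner_secondFundamentalForm_skew (X := X) hY hZ hYh hZh p
  have h2 := hF.inner_secondFundamentalForm_skew (X := Y) hZ hX hZh hXh p
  have h3 := hF.inner_secondFundamentalForm_skew (X := Z) hX hY hXh hYh p
  rw [secondFundamentalForm_symm hF.smooth hX hZ] at h1
  rw [secondFundamentalForm_symm hF.smooth hY hX] at h2
  rw [secondFundamentalForm_symm hF.smooth hZ hY] at h3
  linarith

lemma isSmoothField_sub_horizontalPart [T2Space M₁] (hF : IsRiemannianMap I₁ I₂ F)
    {Y : ∀ p : M₁, TangentSpace I₁ p} (hY : IsSmoothField I₁ Y) :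
    IsSmoothField I₁ (fun p ↦ Y p - horizontalPart I₁ I₂ F p (Y p)) :=
  hY.sub (hF.isSmoothField_horizontalPart hY)

lemma exists_horizontal_field [T2Space M₁] (hF : IsRiemannianMap I₁ I₂ F)
    {v : TangentSpace I₁ p} (hv : v ∈ horizontal I₁ I₂ F p) :
    ∃ Y : ∀ p : M₁, TangentSpace I₁ p, IsSmoothField I₁ Y ∧
      (∀ q, Y q ∈ horizontal I₁ I₂ F q) ∧ Y p = v := by
  obtain ⟨Y, hY, hYp⟩ := exists_isSmoothField_apply_eq v
  exact ⟨_, hF.isSmoothField_horizontalPart hY, fun q ↦ horizontalPart_mem _,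
    by rw [hYp, horizontalPart_eq_self hv]⟩

lemma exists_vertical_field [T2Space M₁] (hF : IsRiemannianMap I₁ I₂ F)
    {v : TangentSpace I₁ p} (hv : v ∈ vertical I₁ I₂ F p) :
    ∃ U : ∀ p : M₁, TangentSpace I₁ p, IsSmoothField I₁ U ∧
      (∀ q, U q ∈ vertical I₁ I₂ F q) ∧ U p = v := by
  obtain ⟨Y, hY, hYp⟩ := exists_isSmoothField_apply_eq v
  refine ⟨_, hF.isSmoothField_sub_horizontalPart hY, fun q ↦ sub_horizontalPart_mem _, ?_⟩
  have h : horizontalPart I₁ I₂ F p v = 0 :=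
    (Submodule.starProjection_apply_eq_zero_iff _).2 (Submodule.le_orthogonal_orthogonal _ hv)
  rw [hYp, h, sub_zero]

lemma exists_normal_field [T2Space M₁] [T2Space M₂] (hF : IsRiemannianMap I₁ I₂ F)
    {v : TangentSpace I₂ (F p)} (hv : v ∈ normalSpace I₁ I₂ F p) :
    ∃ V : ∀ p : M₁, TangentSpace I₂ (F p), IsSmoothAlong I₁ I₂ F V ∧
      (∀ q, V q ∈ normalSpace I₁ I₂ F q) ∧ V p = v := by
  obtain ⟨Y, hY, hYp⟩ := exists_isSmoothField_apply_eq v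
  have hYF : IsSmoothAlong I₁ I₂ F (fun q ↦ Y (F q)) := ContMDiff.comp hY hF.smooth
  exact ⟨_, hF.isSmoothAlong_normalPart hYF, fun q ↦ normalPart_mem _,
    by rw [hYp, normalPart_eq_self hv]⟩

end IsRiemannianMap

/-- Derivative of `g(Y, U) = 0`. It trades the covariant derivative of a horizontal field for that
of a vertical one, which links condition (ii) to the mixed part of the second fundamental form. -/
lemma inner_leviCivita_horizontal_vertical {Y U : ∀ p : M₁, TangentSpace I₁ p}
    (hY : IsSmoothField I₁ Y) (hU : IsSmoothField I₁ U)
    (hYh : ∀ q, Y q ∈ horizontal I₁ I₂ F q) (hUv : ∀ q, U q ∈ vertical I₁ I₂ F q)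
    (v : TangentSpace I₁ p) :
    ⟪leviCivita Y p v, U p⟫_ℝ = -⟪Y p, leviCivita U p v⟫_ℝ := by
  have h := mvfderiv_inner_field (hY.mdifferentiableAt p) (hU.mdifferentiableAt p) v
  have h0 : (fun q ↦ ⟪Y q, U q⟫_ℝ) = fun _ ↦ 0 :=
    funext fun q ↦ inner_horizontal_vertical (hYh q) (hUv q)
  rw [h0, mvfderiv_const] at h
  have h' : (0 : ℝ) = ⟪leviCivita Y p v, U p⟫_ℝ + ⟪Y p, leviCivita U p v⟫_ℝ := h
  linarith

/-! ### Slant maps into almost Hermitian and Kähler manifolds -/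

variable {J : ∀ y : M₂, TangentSpace I₂ y →L[ℝ] TangentSpace I₂ y} {θ : ℝ}

lemma IsAlmostHermitian.inner_skew (hJ : IsAlmostHermitian I₂ J) {y : M₂}
    (u v : TangentSpace I₂ y) : ⟪J y u, v⟫_ℝ = -⟪u, J y v⟫_ℝ := by
  rw [← hJ.inner_map y (J y u) v, hJ.sq, inner_neg_left]

lemma phi_add_omega (u : TangentSpace I₂ (F p)) :
    phi I₁ I₂ J F p u + omega I₁ I₂ J F p u = J (F p) u :=
  tangentialPart_add_normalPart _

lemma calB_add_calC (u : TangentSpace I₂ (F p)) :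
    calB I₁ I₂ J F p u + calC I₁ I₂ J F p u = J (F p) u :=
  tangentialPart_add_normalPart _

lemma phi_add (u v : TangentSpace I₂ (F p)) :
    phi I₁ I₂ J F p (u + v) = phi I₁ I₂ J F p u + phi I₁ I₂ J F p v := by
  simp [phi, tangentialPart]

lemma inner_apply_phi_self (u : TangentSpace I₂ (F p)) :
    ⟪J (F p) u, phi I₁ I₂ J F p u⟫_ℝ = ⟪phi I₁ I₂ J F p u, phi I₁ I₂ J F p u⟫_ℝ :=
  (inner_tangentialPart_of_mem (I₁ := I₁) (J (F p) u) (tangentialPart_mem _)).symm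

/-- `φ u` is the orthogonal projection of `J u`, which has the length of `u`, so its length is `cos
θ · ‖u‖`. -/
lemma IsSlantRiemannianMap.inner_phi_self (hJ : IsAlmostHermitian I₂ J)
    (hF : IsSlantRiemannianMap I₁ I₂ J F θ) {u : TangentSpace I₂ (F p)}
    (hu : u ∈ rangeSpace I₁ I₂ F p) :
    ⟪phi I₁ I₂ J F p u, phi I₁ I₂ J F p u⟫_ℝ = Real.cos θ ^ 2 * ⟪u, u⟫_ℝ := by
  obtain ⟨X, hX, rfl⟩ := exists_horizontal_of_mem_rangeSpace hu
  rcases eq_or_ne X 0 with rfl | hX0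
  · simp [phi, tangentialPart]
  have hθ := hF.angle_eq p X hX hX0
  set u := mfderiv I₁ I₂ F p X
  have h1 := InnerProductGeometry.cos_angle_mul_norm_mul_norm (J (F p) u) (phi I₁ I₂ J F p u)
  have h2 : ‖J (F p) u‖ = ‖u‖ := by
    rw [← sq_eq_sq₀ (norm_nonneg _) (norm_nonneg _), ← real_inner_self_eq_norm_sq,
      ← real_inner_self_eq_norm_sq, hJ.inner_map]
  rw [slantAngle] at hθ
  rw [hθ, inner_apply_phi_self, h2, real_inner_self_eq_norm_sq] at h1
  rw [real_inner_self_eq_norm_sq, real_inner_self_eq_norm_sq]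
  -- If `φ u = 0`, the angle is `π / 2` by convention, and `cos θ = 0` agrees with the formula.
  rcases eq_or_ne (phi I₁ I₂ J F p u) 0 with h0 | h0
  · rw [h0, InnerProductGeometry.angle_zero_right] at hθ
    rw [h0, ← hθ]
    simp
  · have h3 : ‖phi I₁ I₂ J F p u‖ ≠ 0 := norm_ne_zero_iff.2 h0
    have h4 : Real.cos θ * ‖u‖ = ‖phi I₁ I₂ J F p u‖ := mul_right_cancel₀ h3 (by linarith)
    rw [← h4]
    ring

/-- For a slant Riemannian map `φ² = -cos² θ` on the range of `F_*`. -/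
theorem IsSlantRiemannianMap.phi_phi (hJ : IsAlmostHermitian I₂ J)
    (hF : IsSlantRiemannianMap I₁ I₂ J F θ) {u : TangentSpace I₂ (F p)}
    (hu : u ∈ rangeSpace I₁ I₂ F p) :
    phi I₁ I₂ J F p (phi I₁ I₂ J F p u) = -(Real.cos θ ^ 2) • u := by
  -- Polarization of `‖φ u‖² = cos² θ ‖u‖²`. As `φ` is skew-adjoint on the range, this determines
  -- `φ²`: below, `φ² u + cos² θ u` lies in the range and is orthogonal to it.
  have hpol : ∀ v ∈ rangeSpace I₁ I₂ F p,
      ⟪phi I₁ I₂ J F p u, phi I₁ I₂ J F p v⟫_ℝ = Real.cos θ ^ 2 * ⟪u, v⟫_ℝ := by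
    intro v hv
    have h1 := hF.inner_phi_self hJ (Submodule.add_mem _ hu hv)
    rw [phi_add, real_inner_add_add_self, real_inner_add_add_self] at h1
    linarith [hF.inner_phi_self hJ hu, hF.inner_phi_self hJ hv]
  have hmem : phi I₁ I₂ J F p (phi I₁ I₂ J F p u) + (Real.cos θ ^ 2) • u
      ∈ rangeSpace I₁ I₂ F p :=
    Submodule.add_mem _ (tangentialPart_mem _) (Submodule.smul_mem _ _ hu)
  have horth : ∀ v ∈ rangeSpace I₁ I₂ F p,
      ⟪phi I₁ I₂ J F p (phi I₁ I₂ J F p u) + (Real.cos θ ^ 2) • u, v⟫_ℝ = 0 := by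
    intro v hv
    have h1 : ⟪phi I₁ I₂ J F p (phi I₁ I₂ J F p u), v⟫_ℝ
        = -⟪phi I₁ I₂ J F p u, phi I₁ I₂ J F p v⟫_ℝ := by
      rw [phi, inner_tangentialPart_of_mem _ hv, hJ.inner_skew, real_inner_comm,
        real_inner_comm (phi I₁ I₂ J F p v)]
      exact congrArg Neg.neg
        (inner_tangentialPart_of_mem (J (F p) v) (tangentialPart_mem _)).symm
    rw [inner_add_left, h1, hpol v hv, real_inner_smul_left]
    ring
  rw [neg_smul]
  exact eq_neg_of_add_eq_zero_left (inner_self_eq_zero.1 (horth _ hmem))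

/-- The normal component of `∇^F_X F_* Y` for a slant Riemannian map to a Kähler manifold. -/
theorem IsSlantRiemannianMap.sin_sq_mul_inner_pullbackConnection [T2Space M₁] [T2Space M₂]
    (hJ : IsKaehler I₂ J) (hF : IsSlantRiemannianMap I₁ I₂ J F θ)
    {Y : ∀ p : M₁, TangentSpace I₁ p} (hY : IsSmoothField I₁ Y) (v : TangentSpace I₁ p)
    {V : TangentSpace I₂ (F p)} (hV : V ∈ normalSpace I₁ I₂ F p) :
    Real.sin θ ^ 2 * ⟪pullbackConnection I₁ I₂ F (pushforward I₁ I₂ F Y) p v, V⟫_ℝ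
      = ⟪normalConnection I₁ I₂ F
          (fun q ↦ omega I₁ I₂ J F q (pushforward I₁ I₂ F Y q)) p v, calC I₁ I₂ J F p V⟫_ℝ
      - ⟪normalConnection I₁ I₂ F
          (fun q ↦ omega I₁ I₂ J F q (phi I₁ I₂ J F q (pushforward I₁ I₂ F Y q))) p v, V⟫_ℝ
      - ⟪shapeOperator I₁ I₂ F
          (fun q ↦ omega I₁ I₂ J F q (pushforward I₁ I₂ F Y q)) p v, calB I₁ I₂ J F p V⟫_ℝ := by
  have hR := hF.toIsRiemannianMap
  set σ := pushforward I₁ I₂ F Y with hσdef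
  have hσ : IsSmoothAlong I₁ I₂ F σ := hY.pushforward hR.smooth
  have hphi : ∀ {τ : ∀ p : M₁, TangentSpace I₂ (F p)}, IsSmoothAlong I₁ I₂ F τ →
      IsSmoothAlong I₁ I₂ F (fun q ↦ phi I₁ I₂ J F q (τ q)) := fun hτ ↦
    hR.isSmoothAlong_tangentialPart (hJ.isSmoothAlong hR.smooth hτ)
  have homega : ∀ {τ : ∀ p : M₁, TangentSpace I₂ (F p)}, IsSmoothAlong I₁ I₂ F τ →
      IsSmoothAlong I₁ I₂ F (fun q ↦ omega I₁ I₂ J F q (τ q)) := fun hτ ↦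
    hR.isSmoothAlong_normalPart (hJ.isSmoothAlong hR.smooth hτ)
  have hsplit : ∀ {τ : ∀ p : M₁, TangentSpace I₂ (F p)}, IsSmoothAlong I₁ I₂ F τ →
      J (F p) (pullbackConnection I₁ I₂ F τ p v)
        = pullbackConnection I₁ I₂ F (fun q ↦ phi I₁ I₂ J F q (τ q)) p v
          + pullbackConnection I₁ I₂ F (fun q ↦ omega I₁ I₂ J F q (τ q)) p v := by
    intro τ hτ
    rw [← hJ.pullbackConnection_apply (hτ.mdifferentiableAlongAt p),
      ← pullbackConnection_add ((hphi hτ).mdifferentiableAlongAt p)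
        ((homega hτ).mdifferentiableAlongAt p)]
    simp only [phi_add_omega]
  have hphiphi : pullbackConnection I₁ I₂ F
      (fun q ↦ phi I₁ I₂ J F q (phi I₁ I₂ J F q (σ q))) p v
      = -(Real.cos θ ^ 2) • pullbackConnection I₁ I₂ F σ p v := by
    have h1 : (fun q ↦ phi I₁ I₂ J F q (phi I₁ I₂ J F q (σ q)))
        = fun q ↦ -(Real.cos θ ^ 2) • σ q :=
      funext fun q ↦ hF.phi_phi hJ.toIsAlmostHermitian (mfderiv_mem_rangeSpace _)
    rw [h1, pullbackConnection_smul (f := fun _ ↦ -(Real.cos θ ^ 2)) mdifferentiableAt_const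
      (hσ.mdifferentiableAlongAt p), mvfderiv_const]
    simp
  -- Apply the isometry `J` to both entries, move it inside the connection and split `J F_* Y` into
  -- its `φ` and `ω` parts.
  have h1 : ⟪pullbackConnection I₁ I₂ F σ p v, V⟫_ℝ
      = ⟪pullbackConnection I₁ I₂ F (fun q ↦ phi I₁ I₂ J F q (σ q)) p v, J (F p) V⟫_ℝ
        + ⟪pullbackConnection I₁ I₂ F (fun q ↦ omega I₁ I₂ J F q (σ q)) p v, J (F p) V⟫_ℝ := by
    rw [← hJ.inner_map, hsplit hσ, inner_add_left]
  -- Moving `J` back to the left entry creates `φ²`, which returns `cos² θ` times the original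
  -- quantity; subtracting it leaves the factor `sin² θ`.
  have h2 : ⟪pullbackConnection I₁ I₂ F (fun q ↦ phi I₁ I₂ J F q (σ q)) p v, J (F p) V⟫_ℝ
      = Real.cos θ ^ 2 * ⟪pullbackConnection I₁ I₂ F σ p v, V⟫_ℝ
        - ⟪normalConnection I₁ I₂ F
          (fun q ↦ omega I₁ I₂ J F q (phi I₁ I₂ J F q (σ q))) p v, V⟫_ℝ := by
    have h3 := hJ.inner_skew
      (pullbackConnection I₁ I₂ F (fun q ↦ phi I₁ I₂ J F q (σ q)) p v) V
    rw [hsplit (hphi hσ), inner_add_left, hphiphi, real_inner_smul_left] at h3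
    rw [normalConnection, inner_normalPart_of_mem _ hV]
    linarith
  have h4 : ⟪pullbackConnection I₁ I₂ F (fun q ↦ omega I₁ I₂ J F q (σ q)) p v, J (F p) V⟫_ℝ
      = ⟪normalConnection I₁ I₂ F (fun q ↦ omega I₁ I₂ J F q (σ q)) p v, calC I₁ I₂ J F p V⟫_ℝ
        - ⟪shapeOperator I₁ I₂ F (fun q ↦ omega I₁ I₂ J F q (σ q)) p v,
            calB I₁ I₂ J F p V⟫_ℝ := by
    rw [← calB_add_calC (I₁ := I₁) V, inner_add_right, normalConnection, shapeOperator, calB, calC,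
      inner_normalPart_of_mem _ (normalPart_mem _), inner_neg_left,
      inner_tangentialPart_of_mem _ (tangentialPart_mem _)]
    ring
  rw [Real.sin_sq]
  linarith

end Slant

/-! ### Totally geodesic maps and the three conditions -/

section TotallyGeodesic

variable {E₁ H₁ M₁ : Type*} [NormedAddCommGroup E₁] [NormedSpace ℝ E₁] [FiniteDimensional ℝ E₁]
  [TopologicalSpace H₁] {I₁ : ModelWithCorners ℝ E₁ H₁}
  [TopologicalSpace M₁] [ChartedSpace H₁ M₁] [IsManifold I₁ ∞ M₁]
  [RiemannianBundle (fun x : M₁ ↦ TangentSpace I₁ x)]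
  [IsContMDiffRiemannianBundle I₁ ∞ E₁ (fun x : M₁ ↦ TangentSpace I₁ x)]
  {E₂ H₂ M₂ : Type*} [NormedAddCommGroup E₂] [NormedSpace ℝ E₂] [FiniteDimensional ℝ E₂]
  [TopologicalSpace H₂] {I₂ : ModelWithCorners ℝ E₂ H₂}
  [TopologicalSpace M₂] [ChartedSpace H₂ M₂] [IsManifold I₂ ∞ M₂]
  [RiemannianBundle (fun x : M₂ ↦ TangentSpace I₂ x)]
  [IsContMDiffRiemannianBundle I₂ ∞ E₂ (fun x : M₂ ↦ TangentSpace I₂ x)]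
  {F : M₁ → M₂} {p : M₁}

/-- A vector field that vanishes along a curve has vanishing covariant derivative in the direction
of the curve. -/
lemma leviCivita_eq_zero_of_curve {Z : ∀ p : M₁, TangentSpace I₁ p} (hZ : IsSmoothField I₁ Z)
    {γ : ℝ → M₁} {t : ℝ} {v : TangentSpace I₁ (γ t)}
    (hγ : HasMFDerivAt 𝓘(ℝ, ℝ) I₁ γ t ((1 : ℝ →L[ℝ] ℝ).smulRight v))
    (h : ∀ᶠ s in 𝓝 t, Z (γ s) = 0) : leviCivita Z (γ t) v = 0 := by
  -- By the chain rule the derivative is that of `Z ∘ γ` along the curve, and this section is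
  -- locally zero.
  have h1 := pullbackConnection_comp 𝓘(ℝ, ℝ) I₁ hγ.mdifferentiableAt
    (hZ.mdifferentiableAt (γ t)) (1 : ℝ)
  have h3 := (pullbackConnection_congr (I₁ := 𝓘(ℝ, ℝ)) h (1 : ℝ)).trans
    (pullbackConnection_zero hγ.mdifferentiableAt (1 : ℝ))
  rw [hγ.mfderiv] at h1
  have h2 : ((1 : ℝ →L[ℝ] ℝ).smulRight v : ℝ →L[ℝ] TangentSpace I₁ (γ t)) 1 = v := by simp
  exact (congrArg _ h2.symm).trans (h1.symm.trans h3)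

/-- Through every point there is a curve inside the fibre with a given vertical velocity. -/
lemma IsRiemannianMap.exists_curve_in_fibre [T2Space M₁] [T2Space M₂] [I₁.Boundaryless]
    [I₂.Boundaryless] (hF : IsRiemannianMap I₁ I₂ F) {u : TangentSpace I₁ p}
    (hu : u ∈ vertical I₁ I₂ F p) :
    ∃ (γ : ℝ → M₁) (h0 : γ 0 = p), HasMFDerivAt 𝓘(ℝ, ℝ) I₁ γ 0
        ((1 : ℝ →L[ℝ] ℝ).smulRight (h0 ▸ u : TangentSpace I₁ (γ 0))) ∧
      ∀ᶠ t in 𝓝 (0 : ℝ), F (γ t) = F p := by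
  have : CompleteSpace E₁ := FiniteDimensional.complete ℝ E₁
  obtain ⟨U, hU, hUv, rfl⟩ := hF.exists_vertical_field hu
  -- The curve is an integral curve of a vertical extension of `u`. Its image under `F` is an
  -- integral curve of the zero field, as is the constant curve; by uniqueness the two agree near
  -- `0`.
  obtain ⟨γ, rfl, hγ⟩ := exists_isMIntegralCurveAt_of_contMDiffAt_boundaryless 0
    ((hU p).of_le (by simp))
  refine ⟨γ, rfl, hγ.hasMFDerivAt, ?_⟩
  have h0 : IsSmoothField I₂ (fun y : M₂ ↦ (0 : TangentSpace I₂ y)) :=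
    contMDiff_zeroSection ℝ (TangentSpace I₂ : M₂ → Type _)
  have h1 : IsMIntegralCurveAt (F ∘ γ) (fun y : M₂ ↦ (0 : TangentSpace I₂ y)) 0 := by
    refine hγ.mono fun t ht ↦ ?_
    have h2 := HasMFDerivAt.comp t (hF.smooth.mdifferentiable (by simp) (γ t)).hasMFDerivAt ht
    refine h2.congr_mfderiv ?_
    have h3 : mfderiv I₁ I₂ F (γ t) ((1 : ℝ) • U (γ t)) = 0 := by
      rw [one_smul]
      exact hUv (γ t)
    ext
    exact h3.trans (smul_zero (1 : ℝ)).symm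
  have h2 : IsMIntegralCurveAt (fun _ : ℝ ↦ F (γ 0)) (fun y : M₂ ↦ (0 : TangentSpace I₂ y)) 0 := by
    refine Filter.Eventually.of_forall fun t ↦ ?_
    refine (hasMFDerivAt_const (F (γ 0)) t).congr_mfderiv ?_
    ext
    exact (smul_zero (1 : ℝ)).symm
  exact isMIntegralCurveAt_eventuallyEq_of_contMDiffAt_boundaryless
    ((h0 _).of_le (by simp)) h1 h2 rfl

theorem IsTotallyGeodesicMap.fibresTotallyGeodesic [T2Space M₁] [T2Space M₂] [I₁.Boundaryless]
    [I₂.Boundaryless] (hF : IsRiemannianMap I₁ I₂ F) (h : IsTotallyGeodesicMap I₁ I₂ F) :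
    FibresTotallyGeodesic I₁ I₂ F := by
  rintro q U W hU hW hUW p rfl
  have hZ := hF.isSmoothField_horizontalPart hW
  have hW' := hF.isSmoothField_sub_horizontalPart hW
  have h1 := h U _ hU hW' p
  rw [secondFundamentalForm_of_vertical hF.smooth (fun q ↦ sub_horizontalPart_mem _), neg_eq_zero]
    at h1
  -- `W` is vertical only along the fibre, so its horizontal part need not vanish nearby; it does
  -- vanish on a curve in the fibre with velocity `U p`, which is enough. The vertical part of `W`
  -- is handled by `h1`.
  have h2 : leviCivita (fun q ↦ horizontalPart I₁ I₂ F q (W q)) p (U p) = 0 := by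
    obtain ⟨γ, rfl, hγ, hγF⟩ := hF.exists_curve_in_fibre (hUW p rfl).1
    refine leviCivita_eq_zero_of_curve hZ hγ ?_
    filter_upwards [hγF] with t ht
    exact (Submodule.starProjection_apply_eq_zero_iff _).2
      (Submodule.le_orthogonal_orthogonal _ (hUW _ ht).2)
  rw [leviCivita_sub (hW.mdifferentiableAt p) (hZ.mdifferentiableAt p), h2, sub_zero] at h1
  exact h1

theorem IsTotallyGeodesicMap.horizontalTotallyGeodesic [T2Space M₁]
    (hF : IsRiemannianMap I₁ I₂ F) (h : IsTotallyGeodesicMap I₁ I₂ F) :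
    HorizontalTotallyGeodesic I₁ I₂ F := by
  intro X Y hX hY hXh hYh p
  refine (Submodule.mem_orthogonal' _ _).2 fun u hu ↦ ?_
  obtain ⟨U, hU, hUv, rfl⟩ := hF.exists_vertical_field hu
  have h1 := h X U hX hU p
  rw [secondFundamentalForm_of_vertical hF.smooth hUv, neg_eq_zero] at h1
  rw [inner_leviCivita_horizontal_vertical hY hU hYh hUv, inner_horizontal_vertical (hYh p) h1,
    neg_zero]

variable {J : ∀ y : M₂, TangentSpace I₂ y →L[ℝ] TangentSpace I₂ y} {θ : ℝ}

/-- The left side of the `sin² θ` formula vanishes, and what remains is the identity, for every `θ`.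
-/
theorem IsTotallyGeodesicMap.slantIdentity [T2Space M₁] [T2Space M₂] (hJ : IsKaehler I₂ J)
    (hF : IsSlantRiemannianMap I₁ I₂ J F θ) (h : IsTotallyGeodesicMap I₁ I₂ F) :
    SlantIdentity I₁ I₂ J F := by
  intro X Y hX hY _ _ V _ hV p
  have h1 := hF.sin_sq_mul_inner_pullbackConnection hJ hY (X p) (hV p)
  rw [← inner_secondFundamentalForm_of_normal (hV p), h X Y hX hY p, inner_zero_left, mul_zero]
    at h1
  linarith

/-- The angle between a vector and its own projection has nonnegative cosine, which excludes `θ =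
π`. A nonzero horizontal vector must be given, since otherwise the angle condition is empty and does
not restrict `θ`. -/
lemma IsSlantRiemannianMap.sin_sq_ne_zero
    (hF : IsSlantRiemannianMap I₁ I₂ J F θ) (hθ : θ ≠ 0) {X : TangentSpace I₁ p}
    (hX : X ∈ horizontal I₁ I₂ F p) (hX0 : X ≠ 0) : Real.sin θ ^ 2 ≠ 0 := by
  have h := hF.angle_eq p X hX hX0
  rw [slantAngle] at h
  have hcos : 0 ≤ Real.cos θ := by
    rw [← h, InnerProductGeometry.cos_angle, inner_apply_phi_self]
    exact div_nonneg real_inner_self_nonneg (by positivity)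
  have h0 : 0 ≤ θ := h ▸ InnerProductGeometry.angle_nonneg _ _
  have hπ : θ ≤ Real.pi := h ▸ InnerProductGeometry.angle_le_pi _ _
  have hlt : θ < Real.pi := hπ.lt_of_ne fun h1 ↦ by
    rw [h1, Real.cos_pi] at hcos
    linarith
  exact pow_ne_zero 2 (Real.sin_pos_of_pos_of_lt_pi (lt_of_le_of_ne h0 hθ.symm) hlt).ne'

/-- A vector at `F p` vanishes if it is orthogonal to the images of horizontal vectors and to the
normal space. -/
lemma eq_zero_of_inner_range_of_inner_normal {B : TangentSpace I₂ (F p)}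
    (h1 : ∀ w ∈ horizontal I₁ I₂ F p, ⟪B, mfderiv I₁ I₂ F p w⟫_ℝ = 0)
    (h2 : ∀ V ∈ normalSpace I₁ I₂ F p, ⟪B, V⟫_ℝ = 0) : B = 0 := by
  obtain ⟨w, hw, hwB⟩ := exists_horizontal_of_mem_rangeSpace (tangentialPart_mem (I₁ := I₁) B)
  refine inner_self_eq_zero.1 (?_ : ⟪B, B⟫_ℝ = 0)
  conv_lhs => enter [3]; rw [← tangentialPart_add_normalPart (I₁ := I₁) B]
  rw [inner_add_right, ← hwB, h1 w hw, h2 _ (normalPart_mem _), add_zero]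

/-- Each condition kills one block of the second fundamental form: (iii) the horizontal one, (ii)
the mixed one, (i) the vertical one. -/
theorem IsSlantRiemannianMap.isTotallyGeodesicMap [T2Space M₁] [T2Space M₂] [I₁.Boundaryless]
    (hJ : IsKaehler I₂ J) (hF : IsSlantRiemannianMap I₁ I₂ J F θ) (hθ : θ ≠ 0)
    (hfib : FibresTotallyGeodesic I₁ I₂ F) (hhor : HorizontalTotallyGeodesic I₁ I₂ F)
    (hid : SlantIdentity I₁ I₂ J F) : IsTotallyGeodesicMap I₁ I₂ F := by
  have hR := hF.toIsRiemannianMap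
  -- Without nonzero horizontal vectors `θ` is arbitrary and `sin θ` may be zero, but then every
  -- vector is vertical and `F_* = 0`.
  by_cases hex : ∃ q, ∃ X ∈ horizontal I₁ I₂ F q, X ≠ 0
  swap
  · push Not at hex
    have hv : ∀ q (v : TangentSpace I₁ q), v ∈ vertical I₁ I₂ F q := fun q v ↦ by
      have h1 := sub_horizontalPart_mem (I₂ := I₂) (F := F) v
      rwa [hex q _ (horizontalPart_mem v), sub_zero] at h1
    intro X Y _ _ p
    rw [secondFundamentalForm_of_vertical hR.smooth (fun q ↦ hv q _),
      mfderiv_eq_zero_of_mem_vertical (hv p _), neg_zero]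
  obtain ⟨q, X₀, hX₀, hX₀'⟩ := hex
  have hsin := hF.sin_sq_ne_zero hθ hX₀ hX₀'
  have hhh : ∀ X Y : ∀ p : M₁, TangentSpace I₁ p, IsSmoothField I₁ X → IsSmoothField I₁ Y →
      (∀ q, X q ∈ horizontal I₁ I₂ F q) → (∀ q, Y q ∈ horizontal I₁ I₂ F q) →
      ∀ p, secondFundamentalForm I₁ I₂ F X Y p = 0 := by
    intro X Y hX hY hXh hYh p
    refine eq_zero_of_inner_range_of_inner_normal (I₁ := I₁) (fun w hw ↦ ?_) fun v hv ↦ ?_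
    · obtain ⟨Z, hZ, hZh, rfl⟩ := hR.exists_horizontal_field hw
      exact hR.inner_secondFundamentalForm_pushforward hX hY hZ hXh hYh hZh p
    · obtain ⟨V, hV, hVn, rfl⟩ := hR.exists_normal_field hv
      have h1 := hF.sin_sq_mul_inner_pullbackConnection hJ hY (X p) (hVn p)
      rw [← inner_secondFundamentalForm_of_normal (hVn p)] at h1
      have h2 := hid X Y hX hY hXh hYh V hV hVn p
      exact (mul_eq_zero.1 (h1.trans (by linarith))).resolve_left hsin
  have hhv : ∀ X U : ∀ p : M₁, TangentSpace I₁ p, IsSmoothField I₁ X → IsSmoothField I₁ U →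
      (∀ q, X q ∈ horizontal I₁ I₂ F q) → (∀ q, U q ∈ vertical I₁ I₂ F q) →
      ∀ p, secondFundamentalForm I₁ I₂ F X U p = 0 := by
    intro X U hX hU hXh hUv p
    -- Vertical means orthogonal to all horizontal vectors; extend such a vector to a horizontal `Y`
    -- and use that `∇_X Y` is horizontal.
    have h1 : leviCivita U p (X p) ∈ vertical I₁ I₂ F p := by
      rw [← Submodule.orthogonal_orthogonal (vertical I₁ I₂ F p)]
      refine (Submodule.mem_orthogonal _ _).2 fun w hw ↦ ?_
      obtain ⟨Y, hY, hYh, rfl⟩ := hR.exists_horizontal_field hw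
      have h2 := inner_leviCivita_horizontal_vertical hY hU hYh hUv (X p)
      rw [inner_horizontal_vertical (hhor X Y hX hY hXh hYh p) (hUv p)] at h2
      linarith
    rw [secondFundamentalForm_of_vertical hR.smooth hUv, mfderiv_eq_zero_of_mem_vertical h1,
      neg_zero]
  have hvv : ∀ U W : ∀ p : M₁, TangentSpace I₁ p, IsSmoothField I₁ U → IsSmoothField I₁ W →
      (∀ q, U q ∈ vertical I₁ I₂ F q) → (∀ q, W q ∈ vertical I₁ I₂ F q) →
      ∀ p, secondFundamentalForm I₁ I₂ F U W p = 0 := by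
    intro U W hU hW hUv hWv p
    rw [secondFundamentalForm_of_vertical hR.smooth hWv, mfderiv_eq_zero_of_mem_vertical
      (hfib (F p) U W hU hW (fun x _ ↦ ⟨hUv x, hWv x⟩) p rfl), neg_zero]
  intro X Y hX hY p
  have hXs := hR.isSmoothField_horizontalPart hX
  have hXv := hR.isSmoothField_sub_horizontalPart hX
  have hYs := hR.isSmoothField_horizontalPart hY
  have hYv := hR.isSmoothField_sub_horizontalPart hY
  -- Split both fields into horizontal and vertical parts; symmetry turns the vertical-horizontal
  -- block into the horizontal-vertical one.
  rw [secondFundamentalForm_eq_add_left (X := X)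
      (X₁ := fun q ↦ horizontalPart I₁ I₂ F q (X q))
      (X₂ := fun q ↦ X q - horizontalPart I₁ I₂ F q (X q)) (add_sub_cancel _ _).symm,
    secondFundamentalForm_eq_add_right hR.smooth hYs hYv fun q ↦ (add_sub_cancel _ _).symm,
    secondFundamentalForm_eq_add_right hR.smooth hYs hYv fun q ↦ (add_sub_cancel _ _).symm,
    secondFundamentalForm_symm hR.smooth hXv hYs,
    hhh _ _ hXs hYs (fun q ↦ horizontalPart_mem _) (fun q ↦ horizontalPart_mem _),
    hhv _ _ hXs hYv (fun q ↦ horizontalPart_mem _) (fun q ↦ sub_horizontalPart_mem _),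
    hhv _ _ hYs hXv (fun q ↦ horizontalPart_mem _) (fun q ↦ sub_horizontalPart_mem _),
    hvv _ _ hXv hYv (fun q ↦ sub_horizontalPart_mem _) (fun q ↦ sub_horizontalPart_mem _)]
  simp

end TotallyGeodesic

end SlantGeom

end

theorem theorem3p3 {m₁ m₂ : ℕ} {M₁ M₂ : Type*}
    [TopologicalSpace M₁] [T2Space M₁] [SecondCountableTopology M₁]
    [ChartedSpace (EuclideanSpace ℝ (Fin m₁)) M₁] [IsManifold (𝓡 m₁) ∞ M₁]
    [RiemannianBundle (fun x : M₁ ↦ TangentSpace (𝓡 m₁) x)]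
    [IsContMDiffRiemannianBundle (𝓡 m₁) ∞ (EuclideanSpace ℝ (Fin m₁))
      (fun x : M₁ ↦ TangentSpace (𝓡 m₁) x)]
    [TopologicalSpace M₂] [T2Space M₂] [SecondCountableTopology M₂]
    [ChartedSpace (EuclideanSpace ℝ (Fin m₂)) M₂] [IsManifold (𝓡 m₂) ∞ M₂]
    [RiemannianBundle (fun x : M₂ ↦ TangentSpace (𝓡 m₂) x)]
    [IsContMDiffRiemannianBundle (𝓡 m₂) ∞ (EuclideanSpace ℝ (Fin m₂))
      (fun x : M₂ ↦ TangentSpace (𝓡 m₂) x)]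
    (J : ∀ y : M₂, TangentSpace (𝓡 m₂) y →L[ℝ] TangentSpace (𝓡 m₂) y)
    (hJ : SlantGeom.IsKaehler (𝓡 m₂) J)
    (F : M₁ → M₂) (θ : ℝ) (hF : SlantGeom.IsSlantRiemannianMap (𝓡 m₁) (𝓡 m₂) J F θ) :
    (SlantGeom.IsTotallyGeodesicMap (𝓡 m₁) (𝓡 m₂) F →
      SlantGeom.FibresTotallyGeodesic (𝓡 m₁) (𝓡 m₂) F ∧
      SlantGeom.HorizontalTotallyGeodesic (𝓡 m₁) (𝓡 m₂) F ∧
      SlantGeom.SlantIdentity (𝓡 m₁) (𝓡 m₂) J F) ∧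
    (θ ≠ 0 →
      (SlantGeom.FibresTotallyGeodesic (𝓡 m₁) (𝓡 m₂) F ∧
        SlantGeom.HorizontalTotallyGeodesic (𝓡 m₁) (𝓡 m₂) F ∧
        SlantGeom.SlantIdentity (𝓡 m₁) (𝓡 m₂) J F) →
      SlantGeom.IsTotallyGeodesicMap (𝓡 m₁) (𝓡 m₂) F) := by
  have hR := hF.toIsRiemannianMap
  refine ⟨fun h ↦ ⟨h.fibresTotallyGeodesic hR, h.horizontalTotallyGeodesic hR,
    h.slantIdentity hJ hF⟩, fun hθ h ↦ hF.isTotallyGeodesicMap hJ hθ h.1 h.2.1 h.2.2⟩
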